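/- \textbf{Definitions.} A \emph{diffeological $k$-form} on a diffeological space $(X,\mathcal D)$ assigns to every plot $p:U\to X$ a smooth $k$-form $\alpha(p)$ on $U$ such that $\alpha(p\circ F)=F^*\alpha(p)$ for all smooth $F$ between domains; $d$ is defined by $(d\alpha)(p)=d(\alpha(p))$. An $n$-dimensional \emph{orbifold chart} on a topological space $X$ is a triple $(\tilde U,\Gamma,\varphi)$, where $\tilde U\subset\mathbb R^n$ is an open ball, $\Gamma$ is a finite group of smooth automorphisms of $\tilde U$, and $\varphi:\tilde U\to X$ is a $\Gamma$-invariant map inducing a homeomorphism $\tilde U/\Gamma\to\varphi(\tilde U)$. An \emph{embedding} of charts $(\tilde W,\Gamma'',\mu)\to(\tilde U,\Gamma,\varphi)$ is a smooth embedding $\lambda:\tilde W\to\tilde U$ with $\varphi\circ\lambda=\mu$. An \emph{orbifold atlas} on $X$ is a family of orbifold charts whose images cover $X$ and such that for any two charts $(\tilde U,\Gamma,\varphi)$, $(\tilde V,\Gamma',\psi)$ of the family and any $x\in\varphi(\tilde U)\cap\psi(\tilde V)$ there is an orbifold chart, with image an open neighbourhood of $x$, that embeds into both. An \emph{(effective)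 orbifold} is a paracompact Hausdorff space $X$ with an orbifold atlas $\mathcal U$; its \emph{orbifold diffeology} is the diffeology generated by the maps $\varphi$ of the charts. An \emph{orbifold $k$-form} on $(X,\mathcal U)$ is a family of smooth $\Gamma$-invariant $k$-forms $s_{\varphi}$ on $\tilde U$, one for each chart $(\tilde U,\Gamma,\varphi)\in\mathcal U$, such that $\lambda^*s_{\varphi}=\lambda'^*s_{\psi}$ whenever an orbifold chart $(\tilde W,\Gamma'',\mu)$ has embeddings $\lambda$ and $\lambda'$ into two charts $(\tilde U,\Gamma,\varphi)$ and $(\tilde V,\Gamma',\psi)$ of $\mathcal U$; $d$ is computed in each chart. \textbf{Theorem.} (1) Let $(X,\mathcal U)$ be an orbifold. Pullback along the charts, $\beta\mapsto(\varphi^*\beta)_{\varphi}$, is, in every degree $k$, a well-defined linear isomorphism from the diffeological $k$-forms of the orbifold diffeology on $X$ onto the orbifold $k$-forms, and it commutes with $d$. Thus the two complexes are naturally isomorphic. (2) Let $M$ be a smooth $n$-manifold (Hausdorff, second countable, without boundary), let $\Gamma$ be a finite group acting smoothly on $M$, and let $\pi:M\to M/\Gamma$ be the quotient map. Then $M/\Gamma$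 is paracompact and Hausdorff, and the orbifold charts $(\tilde U,\Gamma',\varphi)$ on $M/\Gamma$ that lift to $M$ (that is, $\varphi=\pi\circ\sigma$ for some smooth embedding $\sigma:\tilde U\to M$) form an orbifold atlas, whose orbifold diffeology is the quotient diffeology. In every degree $k$, $\pi^*$ is a linear isomorphism from the diffeological $k$-forms on $M/\Gamma$ onto the $\Gamma$-invariant $k$-forms on $M$; the orbifold $k$-forms $s$ on $M/\Gamma$ are linearly isomorphic to the $\Gamma$-invariant $k$-forms $w$ on $M$ by the correspondence $s_{\varphi}=\sigma^*w$ for all charts $\varphi$ and all lifts $\sigma$; both isomorphisms commute with $d$; and the resulting isomorphism from diffeological to orbifold forms on $M/\Gamma$ is the pullback along the charts, as in (1). -/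

import Mathlib

open Topology
open scoped ContDiff Manifold

noncomputable section

namespace OrbForms

/-- Euclidean space of dimension `n`. -/
abbrev Euc (n : ℕ) : Type := EuclideanSpace ℝ (Fin n)

/-- Alternating `k`-linear forms on the vector space `Euc n`. -/
abbrev Alt (n k : ℕ) : Type := Euc n [⋀^Fin k]→L[ℝ] ℝ

/-- The pullback `f^* w` of a differential form on Euclidean space. -/
def pullback {m n k : ℕ} (f : Euc m → Euc n) (w : Euc n → Alt n k) : Euc m → Alt m k :=
  fun x => (w (f x)).compContinuousLinearMap (fderiv ℝ f x)

theorem contDiffAt_extDeriv {n k : ℕ} {w : Euc n → Alt n k} {x : Euc n}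
    (h : ContDiffAt ℝ ∞ w x) : ContDiffAt ℝ ∞ (extDeriv w) x := by
  have h' : ContDiffAt ℝ ∞ (fderiv ℝ w) x := h.fderiv_right (by simp)
  have hL : ContDiff ℝ ∞ fun g : Euc n →L[ℝ] Alt n k =>
      ContinuousAlternatingMap.alternatizeUncurryFinCLM ℝ (Euc n) ℝ g :=
    ContinuousLinearMap.contDiff _
  exact hL.contDiffAt.comp x h'

theorem extDeriv_pullback_apply {m n k : ℕ} {f : Euc m → Euc n} {w : Euc n → Alt n k} {x : Euc m}
    (hw : ContDiffAt ℝ ∞ w (f x)) (hf : ContDiffAt ℝ ∞ f x) :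
    extDeriv (pullback f w) x = pullback f (extDeriv w) x :=
  extDeriv_pullback (hw.differentiableAt (by simp)) hf
    (by rw [minSmoothness_of_isRCLikeNormedField]; exact WithTop.coe_le_coe.2 (le_top : (2 : ℕ∞) ≤ ⊤))

/-! ### Diffeological forms -/

/-- The plots of a diffeology. -/
structure Plot {X : Type*} (D : DiffeologicalSpace X) where
  dim : ℕ
  toFun : Euc dim → X
  isPlot : toFun ∈ D.plots dim

/-- The plot `p ∘ f`. -/
def Plot.reparam {X : Type*} {D : DiffeologicalSpace X} (p : Plot D) {m : ℕ}
    (f : Euc m → Euc p.dim) (hf : ContDiff ℝ ∞ f) : Plot D :=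
  ⟨m, p.toFun ∘ f, D.plot_reparam p.isPlot hf⟩

/-- Diffeological differential `k`-forms: a smooth `k`-form `α p` on the domain of each plot `p`,
such that `α (p ∘ f) = f^* (α p)`. -/
def DiffForm {X : Type*} (D : DiffeologicalSpace X) (k : ℕ) :
    Submodule ℝ (∀ p : Plot D, Euc p.dim → Alt p.dim k) where
  carrier := {α | (∀ p, ContDiff ℝ ∞ (α p)) ∧
    ∀ (p : Plot D) (m : ℕ) (f : Euc m → Euc p.dim) (hf : ContDiff ℝ ∞ f),
      α (p.reparam f hf) = pullback f (α p)}
  add_mem' := by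
    rintro a b ⟨ha, ha'⟩ ⟨hb, hb'⟩
    refine ⟨fun p => (ha p).add (hb p), fun p m f hf => ?_⟩
    rw [Pi.add_apply, ha', hb']
    rfl
  zero_mem' := ⟨fun p => contDiff_const, fun p m f hf => rfl⟩
  smul_mem' := by
    rintro c a ⟨ha, ha'⟩
    refine ⟨fun p => (ha p).const_smul c, fun p m f hf => ?_⟩
    rw [Pi.smul_apply, ha']
    rfl

/-- The exterior derivative of diffeological forms, `(d α) p = d (α p)`. -/
def diffD {X : Type*} {D : DiffeologicalSpace X} {k : ℕ} (α : DiffForm D k) :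
    DiffForm D (k + 1) :=
  ⟨fun p => extDeriv (α.1 p),
    fun p => contDiff_iff_contDiffAt.2 fun _ => contDiffAt_extDeriv (α.2.1 p).contDiffAt,
    fun p m f hf => by
      refine (congrArg extDeriv (α.2.2 p m f hf)).trans ?_
      exact funext fun x => extDeriv_pullback_apply (α.2.1 p).contDiffAt hf.contDiffAt⟩

/-! ### Orbifolds -/

/-- An `n`-dimensional (effective) orbifold chart on `X`: an open ball `Ũ` in `Euc n`, a finite
group `Γ` of smooth automorphisms of `Ũ`, and a map `φ : Ũ → X` inducing a homeomorphism
`Ũ / Γ → φ(Ũ)`.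

Automorphisms of `Ũ` are recorded as permutations of `Euc n` that are the identity off `Ũ`; since
`Γ` consists of maps, it acts effectively. Only the values of `toFun` on `Ũ` matter.
The last two fields say that the fibres of `φ` on `Ũ` are the `Γ`-orbits and that `Ũ → φ(Ũ)` is a
topological quotient map, which together mean that `φ` induces a homeomorphism `Ũ / Γ → φ(Ũ)`. -/
structure OrbifoldChart (n : ℕ) (X : Type*) [TopologicalSpace X] where
  center : Euc n
  radius : ℝ
  radius_pos : 0 < radius
  group : Subgroup (Equiv.Perm (Euc n))
  finite_group : Finite group
  eq_self_of_notMem : ∀ γ ∈ group, ∀ x ∉ Metric.ball center radius, γ x = x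
  smooth : ∀ γ ∈ group, ContDiffOn ℝ ∞ γ (Metric.ball center radius)
  toFun : Euc n → X
  toFun_eq_iff : ∀ x ∈ Metric.ball center radius, ∀ y ∈ Metric.ball center radius,
    toFun x = toFun y ↔ ∃ γ ∈ group, γ x = y
  isQuotientMap : IsQuotientMap (Set.imageFactorization toFun (Metric.ball center radius))

section Orbifold

variable {n : ℕ} {X : Type*} [TopologicalSpace X]

/-- The ball on which an orbifold chart is defined. -/
def OrbifoldChart.dom (U : OrbifoldChart n X) : Set (Euc n) := Metric.ball U.center U.radius

theorem OrbifoldChart.isOpen_dom (U : OrbifoldChart n X) : IsOpen U.dom := Metric.isOpen_ball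

theorem OrbifoldChart.mem_dom (U : OrbifoldChart n X) {γ : Equiv.Perm (Euc n)} (hγ : γ ∈ U.group)
    {x : Euc n} (hx : x ∈ U.dom) : γ x ∈ U.dom := by
  by_contra h
  exact h ((γ.injective (U.eq_self_of_notMem γ hγ _ h)).symm ▸ hx)

/-- Embeddings of orbifold charts: smooth embeddings `l : W̃ → Ũ` that commute with the maps
to `X`. -/
structure OrbifoldChart.IsChartEmbedding (W U : OrbifoldChart n X) (l : Euc n → Euc n) : Prop where
  mapsTo : Set.MapsTo l W.dom U.dom
  contDiffOn : ContDiffOn ℝ ∞ l W.dom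
  isEmbedding : IsEmbedding (W.dom.domRestrict l)
  immersive : ∀ x ∈ W.dom, Function.Injective (fderiv ℝ l x)
  comm : ∀ x ∈ W.dom, U.toFun (l x) = W.toFun x

/-- Orbifold atlases: families of orbifold charts that cover `X` and are locally compatible. -/
structure IsOrbifoldAtlas (A : Set (OrbifoldChart n X)) : Prop where
  covers : ∀ x : X, ∃ U ∈ A, x ∈ U.toFun '' U.dom
  compatible : ∀ U ∈ A, ∀ V ∈ A, ∀ x ∈ U.toFun '' U.dom ∩ V.toFun '' V.dom,
    ∃ W : OrbifoldChart n X, IsOpen (W.toFun '' W.dom) ∧ x ∈ W.toFun '' W.dom ∧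
      (∃ l, W.IsChartEmbedding U l) ∧ ∃ l, W.IsChartEmbedding V l

/-- The orbifold diffeology: the diffeology generated by the charts of an atlas. -/
@[reducible] def orbifoldDiffeology (A : Set (OrbifoldChart n X)) : DiffeologicalSpace X :=
  DiffeologicalSpace.generateFrom {p | ∃ U ∈ A, ∃ f : Euc p.1 → Euc n,
    ContDiff ℝ ∞ f ∧ (∀ u, f u ∈ U.dom) ∧ p.2 = U.toFun ∘ f}

/-- Orbifold differential `k`-forms with respect to an atlas: a smooth `Γ`-invariant `k`-form `s U`
on the ball of each chart `U`, such that for every chart `W` with embeddings into two charts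
`U` and `V` of the atlas, `s U` and `s V` have the same pullback to `W`.
The values of `s U` off the ball of `U` carry no information and are normalised to be zero. -/
def OrbifoldForm (A : Set (OrbifoldChart n X)) (k : ℕ) :
    Submodule ℝ (∀ _ : A, Euc n → Alt n k) where
  carrier := {s |
    (∀ U : A, ContDiffOn ℝ ∞ (s U) U.1.dom) ∧
    (∀ U : A, ∀ x ∉ U.1.dom, s U x = 0) ∧
    (∀ U : A, ∀ γ ∈ U.1.group, Set.EqOn (pullback γ (s U)) (s U) U.1.dom) ∧
    (∀ (U V : A) (W : OrbifoldChart n X) (l l' : Euc n → Euc n),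
      W.IsChartEmbedding U.1 l → W.IsChartEmbedding V.1 l' →
      Set.EqOn (pullback l (s U)) (pullback l' (s V)) W.dom)}
  add_mem' := by
    rintro a b ⟨ha, ha0, hai, hac⟩ ⟨hb, hb0, hbi, hbc⟩
    refine ⟨fun U => (ha U).add (hb U), fun U x hx => ?_, fun U γ hγ x hx => ?_,
      fun U V W l l' hl hl' x hx => ?_⟩
    · simp [ha0 U x hx, hb0 U x hx]
    · exact congrArg₂ (· + ·) (hai U γ hγ hx) (hbi U γ hγ hx)
    · exact congrArg₂ (· + ·) (hac U V W l l' hl hl' hx) (hbc U V W l l' hl hl' hx)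
  zero_mem' := ⟨fun _ => contDiffOn_const, fun _ _ _ => rfl, fun _ _ _ _ _ => rfl,
    fun _ _ _ _ _ _ _ _ _ => rfl⟩
  smul_mem' := by
    rintro c a ⟨ha, ha0, hai, hac⟩
    refine ⟨fun U => (ha U).const_smul c, fun U x hx => ?_, fun U γ hγ x hx => ?_,
      fun U V W l l' hl hl' x hx => ?_⟩
    · simp [ha0 U x hx]
    · exact congrArg (c • ·) (hai U γ hγ hx)
    · exact congrArg (c • ·) (hac U V W l l' hl hl' hx)

theorem pullback_congr {m k : ℕ} {f : Euc m → Euc n} {w η : Euc n → Alt n k} {x : Euc m}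
    (h : w (f x) = η (f x)) : pullback f w x = pullback f η x := by
  simp only [pullback, h]

/-- The exterior derivative of orbifold forms, computed in each chart. -/
def orbD {A : Set (OrbifoldChart n X)} {k : ℕ} (s : OrbifoldForm A k) :
    OrbifoldForm A (k + 1) :=
  ⟨fun U => U.1.dom.indicator (extDeriv (s.1 U)), by
    obtain ⟨hs, -, hi, hc⟩ := s.2
    have hsm : ∀ U : A, ∀ x ∈ U.1.dom, ContDiffAt ℝ ∞ (s.1 U) x := fun U x hx =>
      (hs U).contDiffAt (U.1.isOpen_dom.mem_nhds hx)
    have key : ∀ (U : A) (f : Euc n → Euc n) (S : Set (Euc n)), IsOpen S → ContDiffOn ℝ ∞ f S →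
        Set.MapsTo f S U.1.dom → ∀ x ∈ S,
        pullback f (U.1.dom.indicator (extDeriv (s.1 U))) x =
          extDeriv (pullback f (s.1 U)) x := fun U f S hS hf hm x hx => by
      rw [extDeriv_pullback_apply (hsm U _ (hm hx)) (hf.contDiffAt (hS.mem_nhds hx))]
      exact pullback_congr (Set.indicator_of_mem (hm hx) _)
    refine ⟨fun U => ?_, fun U x hx => Set.indicator_of_notMem hx _, fun U γ hγ x hx => ?_,
      fun U V W l l' hl hl' x hx => ?_⟩
    · refine ContDiffOn.congr (f := extDeriv (s.1 U)) (fun x hx => ?_)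
        fun x hx => Set.indicator_of_mem hx _
      exact (contDiffAt_extDeriv (hsm U x hx)).contDiffWithinAt
    · rw [key U γ _ U.1.isOpen_dom (U.1.smooth γ hγ) (fun y hy => U.1.mem_dom hγ hy) x hx]
      refine Eq.trans ?_ (Set.indicator_of_mem hx _).symm
      exact Filter.EventuallyEq.extDeriv_eq
        ((hi U γ hγ).eventuallyEq_of_mem (U.1.isOpen_dom.mem_nhds hx))
    · rw [key U l _ W.isOpen_dom hl.contDiffOn hl.mapsTo x hx,
        key V l' _ W.isOpen_dom hl'.contDiffOn hl'.mapsTo x hx]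
      exact Filter.EventuallyEq.extDeriv_eq
        ((hc U V W l l' hl hl').eventuallyEq_of_mem (W.isOpen_dom.mem_nhds hx))⟩

/-- `s U` is the pullback of the diffeological form `β` along the chart `φ : Ũ → X`, for every
chart `U` of the atlas: whenever a plot factors as `φ ∘ f` with `f` smooth into `Ũ`, the value of
`β` on this plot is `f^* (s U)`. -/
def IsChartPullback {D : DiffeologicalSpace X} {A : Set (OrbifoldChart n X)} {k : ℕ}
    (β : DiffForm D k) (s : OrbifoldForm A k) : Prop :=
  ∀ (U : A) (p : Plot D) (f : Euc p.dim → Euc n), ContDiff ℝ ∞ f → (∀ u, f u ∈ U.1.dom) →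
    p.toFun = U.1.toFun ∘ f → β.1 p = pullback f (s.1 U)

end Orbifold

/-! ### Forms on manifolds and quotients by finite groups -/

section Manifold

variable {n : ℕ} {M : Type*} [TopologicalSpace M] [ChartedSpace (EuclideanSpace ℝ (Fin n)) M]

/-- The pullback of a family `w` of alternating forms on the tangent spaces of `M` along a map
from Euclidean space to `M`. -/
def mpullback {m k : ℕ} (q : Euc m → M)
    (w : ∀ x : M, TangentSpace (𝓡 n) x [⋀^Fin k]→L[ℝ] ℝ) : Euc m → Alt m k :=
  fun u => (w (q u)).compContinuousLinearMap (mfderiv (𝓡 m) (𝓡 n) q u)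

/-- Smooth families of alternating forms: the coordinate expression in each chart is smooth. -/
def IsSmoothForm {k : ℕ} (w : ∀ x : M, TangentSpace (𝓡 n) x [⋀^Fin k]→L[ℝ] ℝ) : Prop :=
  ∀ e ∈ atlas (EuclideanSpace ℝ (Fin n)) M, ContDiffOn ℝ ∞ (mpullback e.symm w) e.target

/-- The exterior derivative of a form on a manifold, computed at `x` in the chart around `x`. -/
def mextDeriv {k : ℕ} (w : ∀ x : M, TangentSpace (𝓡 n) x [⋀^Fin k]→L[ℝ] ℝ) (x : M) :
    TangentSpace (𝓡 n) x [⋀^Fin (k + 1)]→L[ℝ] ℝ :=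
  (extDeriv (mpullback (chartAt (EuclideanSpace ℝ (Fin n)) x).symm w)
      (chartAt (EuclideanSpace ℝ (Fin n)) x x)).compContinuousLinearMap
    (mfderiv (𝓡 n) (𝓡 n) (chartAt (EuclideanSpace ℝ (Fin n)) x) x)

variable (n M) in
/-- Differential `k`-forms on `M` that are invariant under the action of `Γ`. -/
def InvariantForm (Γ : Type*) [Group Γ] [MulAction Γ M] (k : ℕ) :
    Submodule ℝ (∀ x : M, TangentSpace (𝓡 n) x [⋀^Fin k]→L[ℝ] ℝ) where
  carrier := {w | IsSmoothForm w ∧ ∀ (γ : Γ) (x : M),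
    (w (γ • x)).compContinuousLinearMap (mfderiv (𝓡 n) (𝓡 n) (fun y : M => γ • y) x) = w x}
  add_mem' := by
    rintro a b ⟨ha, ha'⟩ ⟨hb, hb'⟩
    exact ⟨fun e he => (ha e he).add (hb e he),
      fun γ x => congrArg₂ (· + ·) (ha' γ x) (hb' γ x)⟩
  zero_mem' := ⟨fun _ _ => contDiffOn_const (c := 0), fun _ _ => rfl⟩
  smul_mem' := by
    rintro c a ⟨ha, ha'⟩
    exact ⟨fun e he => (ha e he).const_smul c, fun γ x => congrArg (c • ·) (ha' γ x)⟩

variable (n M) in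
/-- The quotient diffeology on `M / Γ`: the diffeology generated by the maps `π ∘ q`, where `q` is
a smooth map from a Euclidean space to `M`. -/
@[reducible] def quotientDiffeology (Γ : Type*) [Group Γ] [MulAction Γ M] :
    DiffeologicalSpace (Quotient (MulAction.orbitRel Γ M)) :=
  DiffeologicalSpace.generateFrom {p | ∃ q : Euc p.1 → M, ContMDiff (𝓡 p.1) (𝓡 n) ∞ q ∧
    p.2 = fun u => Quotient.mk (MulAction.orbitRel Γ M) (q u)}

/-- A lift of an orbifold chart on `M / Γ` to `M`: a smooth embedding `σ : Ũ → M` with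
`π ∘ σ = φ`. -/
structure IsLift {Γ : Type*} [Group Γ] [MulAction Γ M]
    (U : OrbifoldChart n (Quotient (MulAction.orbitRel Γ M))) (σ : Euc n → M) : Prop where
  contMDiffOn : ContMDiffOn (𝓡 n) (𝓡 n) ∞ σ U.dom
  isEmbedding : IsEmbedding (U.dom.domRestrict σ)
  immersive : ∀ x ∈ U.dom, Function.Injective (mfderiv (𝓡 n) (𝓡 n) σ x)
  comm : ∀ x ∈ U.dom, Quotient.mk (MulAction.orbitRel Γ M) (σ x) = U.toFun x

variable (n M) in
/-- The orbifold atlas of `M / Γ`: all orbifold charts that lift to `M`. -/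
def quotientAtlas (Γ : Type*) [Group Γ] [MulAction Γ M] :
    Set (OrbifoldChart n (Quotient (MulAction.orbitRel Γ M))) :=
  {U | ∃ σ : Euc n → M, IsLift U σ}

end Manifold

end OrbForms

end

namespace OrbForms

/-! ### Pullbacks of forms on Euclidean space -/

section Pullback

variable {m n l k : ℕ}

/-! Every plot of the orbifold diffeology lifts locally to charts, so a diffeological form is
determined by its values on charts. The content of (1) is that the pullback of an orbifold form
along a local lift of a plot does not depend on the lift. If `f` and `g` lift the same map to one
chart, then `g x = γ (f x)` with `γ` in the finite group of the chart, but `γ` may jump with `x`.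
The finitely many closed sets where `γ ∘ f = g` cover the domain, hence the union of their interiors
is dense. Near an interior point the two pullbacks agree by invariance, and elsewhere by continuity
(`eqOn_of_finite_cover`, `pullback_eq_of_lifts`). Lifts to two different charts are first moved into
a common smaller chart (`orbifoldForm_pullback_eq`). In the other direction, evaluating a
diffeological form on a plot that parametrises a chart gives the orbifold form.

For (2) the geometric input is `exists_invariant_ball`: small balls preserved by the stabiliser of a
point and moved off themselves by all other group elements. They come from linearising the
stabiliser. In a chart, `x ↦ (γ x - a)_γ` is an equivariant map to a product of copies of Euclidean
space, on which the group acts by permuting factors isometrically; projecting orthogonally to the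
image of its derivative at the fixed point gives coordinates in which the group preserves the norm.
Such balls provide the charts and the common refinements, and smooth maps to `M` factor locally
through them, whence the equality of diffeologies. The density argument, now for maps to `M`, shows
that the pullback of an invariant form along a lift depends only on the map to `M / Γ`; conversely
the form on `M` is recovered from an orbifold form by inverting the derivatives of lifts.

Plots are defined on whole Euclidean spaces and charts on balls; the diffeomorphism `ballMap`
mediates. The basic correspondences are handled as linear relations (`IsChartPullback`,
`IsLiftPullback`), total and unique on both sides; compatibility with the exterior derivative then
follows from uniqueness. -/

theorem exists_leftInverse_toContinuousMultilinearMap (E : Type*) [NormedAddCommGroup E]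
    [NormedSpace ℝ E] (k : ℕ) :
    ∃ r : ContinuousMultilinearMap ℝ (fun _ : Fin k => E) ℝ →L[ℝ] E [⋀^Fin k]→L[ℝ] ℝ,
      ∀ w : E [⋀^Fin k]→L[ℝ] ℝ, r w.toContinuousMultilinearMap = w := by
  let a : ContinuousMultilinearMap ℝ (fun _ : Fin k => E) ℝ →ₗ[ℝ] E [⋀^Fin k]→L[ℝ] ℝ :=
    { toFun := fun f => f.alternatization
      map_add' := map_add _
      map_smul' := fun c f => by
        ext v
        simp only [ContinuousMultilinearMap.alternatization_apply_apply, RingHom.id_apply,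
          ContinuousAlternatingMap.smul_apply, smul_apply, Finset.smul_sum]
        exact Finset.sum_congr rfl fun σ _ => smul_comm _ _ _ }
  have ha : ∀ f, ‖a f‖ ≤ (k.factorial : ℝ) * ‖f‖ := fun f => by
    refine ContinuousAlternatingMap.opNorm_le_bound _ (by positivity) fun v => ?_
    change ‖f.alternatization v‖ ≤ _
    rw [ContinuousMultilinearMap.alternatization_apply_apply]
    refine (norm_sum_le _ _).trans ?_
    have : ∀ σ ∈ (Finset.univ : Finset (Equiv.Perm (Fin k))),
        ‖Equiv.Perm.sign σ • f (v ∘ σ)‖ ≤ ‖f‖ * ∏ i, ‖v i‖ := fun σ _ => by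
      have h1 : ‖Equiv.Perm.sign σ • f (v ∘ σ)‖ = ‖f (v ∘ σ)‖ := by
        rcases Int.units_eq_one_or (Equiv.Perm.sign σ) with h | h <;> simp [h]
      rw [h1]
      refine (f.le_opNorm _).trans (le_of_eq ?_)
      rw [← Equiv.prod_comp σ fun i => ‖v i‖]
      rfl
    refine (Finset.sum_le_sum this).trans (le_of_eq ?_)
    simp [Fintype.card_perm, mul_assoc]
  -- Alternatization sums over all permutations without averaging, so on alternating maps it is
  -- multiplication by `k!`.
  refine ⟨(k.factorial : ℝ)⁻¹ • a.mkContinuous _ ha, fun w => ?_⟩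
  have hw := congrArg DFunLike.coe (AlternatingMap.coe_alternatization w.toAlternatingMap)
  ext v
  have hv := congrFun hw v
  have : w.toContinuousMultilinearMap.alternatization v = (k.factorial : ℝ) * w v := by
    rw [ContinuousMultilinearMap.alternatization_apply_apply]
    rw [MultilinearMap.alternatization_apply] at hv
    simpa [Function.comp_def] using hv
  change (k.factorial : ℝ)⁻¹ • (w.toContinuousMultilinearMap.alternatization v) = _
  rw [this, smul_eq_mul, inv_mul_cancel_left₀ (by positivity)]

/-- For multilinear maps, precomposition is polynomial in the linear maps and linear in the form,
hence smooth. The continuous linear retraction `r` onto alternating maps carries this over. -/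
theorem contDiff_compContinuousLinearMap :
    ContDiff ℝ ∞ fun q : Alt n k × (Euc m →L[ℝ] Euc n) => q.1.compContinuousLinearMap q.2 := by
  obtain ⟨r, hr⟩ := exists_leftInverse_toContinuousMultilinearMap (Euc m) k
  have h1 : ContDiff ℝ ∞ fun q : Alt n k × (Euc m →L[ℝ] Euc n) =>
      ContinuousMultilinearMap.compContinuousLinearMapContinuousMultilinear ℝ
        (fun _ : Fin k => Euc m) (fun _ : Fin k => Euc n) ℝ fun _ => q.2 :=
    (ContinuousMultilinearMap.contDiff _).comp (contDiff_pi.2 fun _ => contDiff_snd)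
  have h2 : ContDiff ℝ ∞ fun q : Alt n k × (Euc m →L[ℝ] Euc n) =>
      ContinuousAlternatingMap.toContinuousMultilinearMapCLM ℝ q.1 :=
    (ContinuousLinearMap.contDiff _).comp contDiff_fst
  have h3 := r.contDiff.comp (h1.clm_apply h2)
  have h4 : (fun q : Alt n k × (Euc m →L[ℝ] Euc n) => q.1.compContinuousLinearMap q.2) =
      fun q => r (q.1.compContinuousLinearMap q.2).toContinuousMultilinearMap :=
    funext fun q => (hr _).symm
  rw [h4]
  exact h3

theorem contDiffAt_pullback {f : Euc m → Euc n} {w : Euc n → Alt n k} {x : Euc m}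
    (hw : ContDiffAt ℝ ∞ w (f x)) (hf : ContDiffAt ℝ ∞ f x) :
    ContDiffAt ℝ ∞ (pullback f w) x :=
  contDiff_compContinuousLinearMap.contDiffAt.comp x
    ((hw.comp x hf).prodMk (hf.fderiv_right (by simp)))

theorem contDiffOn_pullback {f : Euc m → Euc n} {w : Euc n → Alt n k} {S : Set (Euc m)}
    {T : Set (Euc n)} (hS : IsOpen S) (hT : IsOpen T) (hw : ContDiffOn ℝ ∞ w T)
    (hf : ContDiffOn ℝ ∞ f S) (h : Set.MapsTo f S T) : ContDiffOn ℝ ∞ (pullback f w) S :=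
  fun _ hx => (contDiffAt_pullback (hw.contDiffAt (hT.mem_nhds (h hx)))
    (hf.contDiffAt (hS.mem_nhds hx))).contDiffWithinAt

theorem pullback_comp_apply {f : Euc m → Euc n} {g : Euc l → Euc m} {w : Euc n → Alt n k}
    {x : Euc l} (hf : DifferentiableAt ℝ f (g x)) (hg : DifferentiableAt ℝ g x) :
    pullback (f ∘ g) w x = pullback g (pullback f w) x := by
  simp only [pullback, Function.comp_apply, fderiv_comp x hf hg]
  rfl

theorem pullback_congr_map {f g : Euc m → Euc n} {w : Euc n → Alt n k} {x : Euc m}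
    (h : f =ᶠ[𝓝 x] g) : pullback f w x = pullback g w x := by
  simp only [pullback, h.fderiv_eq, h.eq_of_nhds]

theorem pullback_id (w : Euc n → Alt n k) : pullback id w = w := by
  funext x
  simp only [pullback, fderiv_id]
  rfl

theorem compContinuousLinearMap_injective {E F : Type*} [NormedAddCommGroup E] [NormedSpace ℝ E]
    [NormedAddCommGroup F] [NormedSpace ℝ F] {L : E →L[ℝ] F} (hL : Function.Surjective L) :
    Function.Injective fun w : F [⋀^Fin k]→L[ℝ] ℝ => w.compContinuousLinearMap L := by
  intro w η h
  ext v
  choose u hu using fun i => hL (v i)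
  have := congrArg (fun z => z u) h
  simpa [Function.comp_def, hu] using this

theorem eq_of_pullback_eq {f : Euc m → Euc n} {w η : Euc n → Alt n k} {x : Euc m}
    (hf : Function.Surjective (fderiv ℝ f x)) (h : pullback f w x = pullback f η x) :
    w (f x) = η (f x) :=
  compContinuousLinearMap_injective hf h

/-- A diffeomorphism of `Euc n` onto the ball with centre `c` and radius `r`. -/
noncomputable def ballMap (c : Euc n) (r : ℝ) : Euc n → Euc n :=
  OpenPartialHomeomorph.univBall c r

/-- The inverse of `ballMap`. -/
noncomputable def ballInv (c : Euc n) (r : ℝ) : Euc n → Euc n :=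
  (OpenPartialHomeomorph.univBall c r).symm

theorem contDiff_ballMap (c : Euc n) (r : ℝ) : ContDiff ℝ ∞ (ballMap c r) :=
  OpenPartialHomeomorph.contDiff_univBall

theorem contDiffOn_ballInv (c : Euc n) (r : ℝ) :
    ContDiffOn ℝ ∞ (ballInv c r) (Metric.ball c r) :=
  OpenPartialHomeomorph.contDiffOn_univBall_symm

theorem ballMap_mem {c : Euc n} {r : ℝ} (hr : 0 < r) (x : Euc n) :
    ballMap c r x ∈ Metric.ball c r := by
  have := (OpenPartialHomeomorph.univBall c r).map_source (x := x) (by simp)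
  rwa [OpenPartialHomeomorph.univBall_target c hr] at this

theorem ballInv_ballMap (c : Euc n) (r : ℝ) (x : Euc n) : ballInv c r (ballMap c r x) = x :=
  (OpenPartialHomeomorph.univBall c r).left_inv (by simp)

theorem ballMap_ballInv {c : Euc n} {r : ℝ} {y : Euc n} (hy : y ∈ Metric.ball c r) :
    ballMap c r (ballInv c r y) = y :=
  (OpenPartialHomeomorph.univBall c r).right_inv
    (OpenPartialHomeomorph.ball_subset_univBall_target c r hy)

theorem ballMap_zero (c : Euc n) (r : ℝ) : ballMap c r 0 = c :=
  OpenPartialHomeomorph.univBall_apply_zero c r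

/-- The chain rule for `ballInv ∘ ballMap = id` makes the derivative injective, hence surjective in
equal dimensions. This is what allows a form on a ball to be recovered from its pullback to
Euclidean space. -/
theorem surjective_fderiv_ballMap {c : Euc n} {r : ℝ} (hr : 0 < r) (x : Euc n) :
    Function.Surjective (fderiv ℝ (ballMap c r) x) := by
  have h1 : HasFDerivAt (ballMap c r) (fderiv ℝ (ballMap c r) x) x :=
    ((contDiff_ballMap c r).differentiable (by simp) x).hasFDerivAt
  have h2 : HasFDerivAt (ballInv c r) (fderiv ℝ (ballInv c r) (ballMap c r x)) (ballMap c r x) :=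
    (((contDiffOn_ballInv c r).contDiffAt
      (Metric.isOpen_ball.mem_nhds (ballMap_mem hr x))).differentiableAt (by simp)).hasFDerivAt
  have h3 := h2.comp x h1
  have h4 : HasFDerivAt (ballInv c r ∘ ballMap c r) (ContinuousLinearMap.id ℝ (Euc n)) x :=
    (hasFDerivAt_id x).congr_of_eventuallyEq (.of_forall (ballInv_ballMap c r))
  have h5 := h3.unique h4
  have hinj : Function.Injective (fderiv ℝ (ballMap c r) x) := fun u v huv => by
    have := fun z => DFunLike.congr_fun h5 z
    simp only [ContinuousLinearMap.comp_apply, ContinuousLinearMap.id_apply] at this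
    rw [← this u, ← this v, huv]
  exact LinearMap.injective_iff_surjective.1 hinj

/-- A form on an open subset of Euclidean space can be compared on small balls. -/
theorem eq_of_pullback_ballMap {c : Euc n} {r : ℝ} (hr : 0 < r) {w η : Euc n → Alt n k}
    (h : pullback (ballMap c r) w = pullback (ballMap c r) η) :
    Set.EqOn w η (Metric.ball c r) := fun y hy => by
  have := eq_of_pullback_eq (surjective_fderiv_ballMap hr (ballInv c r y)) (congrFun h _)
  rwa [ballMap_ballInv hy] at this

end Pullback

/-! ### Two topological lemmas -/

/-- Functions that agree wherever `g` locally coincides with one of finitely many `f i` agree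
everywhere, if `g` takes at each point the value of some `f i`. -/
theorem eqOn_of_finite_cover {X Y Z ι : Type*} [TopologicalSpace X] [LocallyCompactSpace X]
    [T2Space X] [TopologicalSpace Y] [T2Space Y] [TopologicalSpace Z] [T2Space Z] [Finite ι]
    {O : Set X} (hO : IsOpen O) {h₁ h₂ : X → Y} (hh₁ : ContinuousOn h₁ O)
    (hh₂ : ContinuousOn h₂ O) {g : X → Z} {f : ι → X → Z} (hg : ContinuousOn g O)
    (hf : ∀ i, ContinuousOn (f i) O) (hgf : ∀ x ∈ O, ∃ i, f i x = g x)
    (H : ∀ i, ∀ x ∈ O, f i =ᶠ[𝓝 x] g → h₁ x = h₂ x) : Set.EqOn h₁ h₂ O := by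
  by_contra hne
  simp only [Set.EqOn, not_forall] at hne
  obtain ⟨x, hx, hxne⟩ := hne
  let V : Set X := O ∩ {y | h₁ y ≠ h₂ y}
  have hV : IsOpen V := by
    have : IsOpen (O ∩ (fun y => (h₁ y, h₂ y)) ⁻¹' {q : Y × Y | q.1 ≠ q.2}) :=
      (hh₁.prodMk hh₂).isOpen_inter_preimage hO (isOpen_ne_fun continuous_fst continuous_snd)
    exact this
  have : LocallyCompactSpace V := hV.locallyCompactSpace
  have : Nonempty V := ⟨⟨x, hx, hxne⟩⟩
  have hVO : V ⊆ O := Set.inter_subset_left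
  -- The open set `V` where `h₁` and `h₂` differ is a Baire space, so one of the finitely many
  -- closed sets `f i = g` has an interior point in `V`. There `H` contradicts `h₁ ≠ h₂`.
  obtain ⟨i, y, hy⟩ := nonempty_interior_of_iUnion_of_closed
    (f := fun i => {y : V | f i y = g y})
    (fun i => isClosed_eq ((hf i).mono hVO).domRestrict (hg.mono hVO).domRestrict)
    (by
      ext y
      simpa using hgf y (hVO y.2))
  rw [mem_interior_iff_mem_nhds] at hy
  refine y.2.2 (H i y (hVO y.2) ?_)
  have : ∀ᶠ z : V in 𝓝 y, f i z = g z := hy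
  rw [← hV.nhdsWithin_eq y.2, Filter.EventuallyEq]
  rw [← map_nhds_subtype_val]
  exact this

/-! ### The inverse function theorem for maps into a manifold -/

section Inverse

variable {n : ℕ} {M : Type*} [TopologicalSpace M] [ChartedSpace (EuclideanSpace ℝ (Fin n)) M]
  [IsManifold (𝓡 n) ∞ M]

theorem contMDiffAt_chartAt (x : M) {y : M} (hy : y ∈ (chartAt (Euc n) x).source) :
    ContMDiffAt (𝓡 n) (𝓡 n) ∞ (chartAt (Euc n) x) y :=
  (contMDiffOn_chart (I := 𝓡 n) (x := x)).contMDiffAt ((chartAt (Euc n) x).open_source.mem_nhds hy)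

theorem bijective_of_injective {L : Euc n →L[ℝ] Euc n} (h : Function.Injective L) :
    Function.Bijective L :=
  ⟨h, LinearMap.injective_iff_surjective.1 h⟩

theorem exists_compContinuousLinearMap_eq {k : ℕ} {L : Euc n →L[ℝ] Euc n}
    (hL : Function.Injective L) (s : Alt n k) : ∃ w : Alt n k, w.compContinuousLinearMap L = s := by
  let L' : Euc n ≃L[ℝ] Euc n := (LinearEquiv.ofBijective (L : Euc n →ₗ[ℝ] Euc n)
    (bijective_of_injective hL)).toContinuousLinearEquiv
  refine ⟨s.compContinuousLinearMap (L'.symm : Euc n →L[ℝ] Euc n), ?_⟩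
  ext z
  exact congrArg s (funext fun i => L'.symm_apply_apply (z i))

theorem injective_mfderiv_chartAt (x : M) {y : M} (hy : y ∈ (chartAt (Euc n) x).source) :
    Function.Injective (mfderiv (𝓡 n) (𝓡 n) (chartAt (Euc n) x) y) := by
  have h := mdifferentiable_chart (I := 𝓡 n) x
  exact h.mfderiv_injective hy

theorem exists_hasFDerivAt_equiv {f : Euc n → Euc n} {x : Euc n} (hf : DifferentiableAt ℝ f x)
    (h : Function.Injective (fderiv ℝ f x)) :
    ∃ L : Euc n ≃L[ℝ] Euc n, HasFDerivAt f (L : Euc n →L[ℝ] Euc n) x := by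
  refine ⟨(LinearEquiv.ofBijective (fderiv ℝ f x : Euc n →ₗ[ℝ] Euc n)
    (bijective_of_injective h)).toContinuousLinearEquiv, ?_⟩
  convert hf.hasFDerivAt
  ext v
  rfl

theorem injective_fderiv_chartAt_comp {f : Euc n → M} {x : Euc n}
    (hf : ContMDiffAt (𝓡 n) (𝓡 n) ∞ f x)
    (h : Function.Injective (mfderiv (𝓡 n) (𝓡 n) f x)) {y : M}
    (hy : f x ∈ (chartAt (Euc n) y).source) :
    ContDiffAt ℝ ∞ (chartAt (Euc n) y ∘ f) x ∧
      Function.Injective (fderiv ℝ (chartAt (Euc n) y ∘ f) x) := by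
  have hc := contMDiffAt_chartAt y hy
  refine ⟨(hc.comp x hf).contDiffAt, ?_⟩
  rw [← mfderiv_eq_fderiv, mfderiv_comp x (hc.mdifferentiableAt (by simp))
    (hf.mdifferentiableAt (by simp))]
  exact (injective_mfderiv_chartAt y hy).comp h

/-- Read in a chart of `M`, the derivative is invertible because the dimensions agree, so the
inverse function theorem applies. This gives openness of immersions. -/
theorem map_nhds_eq_of_injective_mfderiv {f : Euc n → M} {x : Euc n}
    (hf : ContMDiffAt (𝓡 n) (𝓡 n) ∞ f x)
    (h : Function.Injective (mfderiv (𝓡 n) (𝓡 n) f x)) : Filter.map f (𝓝 x) = 𝓝 (f x) := by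
  set c := chartAt (Euc n) (f x)
  have hx : f x ∈ c.source := mem_chart_source _ _
  obtain ⟨h1, h2⟩ := injective_fderiv_chartAt_comp hf h hx
  obtain ⟨L, hL⟩ := exists_hasFDerivAt_equiv (h1.differentiableAt (by simp)) h2
  have h3 := (h1.hasStrictFDerivAt' hL (by simp)).map_nhds_eq_of_equiv
  have h4 : Filter.map c.symm (Filter.map (c ∘ f) (𝓝 x)) = 𝓝 (f x) := by
    rw [h3, Function.comp_apply, c.symm.map_nhds_eq (c.map_source hx), c.left_inv hx]
  rw [← h4, Filter.map_map]
  refine Filter.map_congr ?_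
  filter_upwards [hf.continuousAt (c.open_source.mem_nhds hx)] with y hy
  exact (c.left_inv hy).symm

/-- An injective immersion of an open subset of Euclidean space into a manifold of the same
dimension is a diffeomorphism onto an open subset. -/
theorem exists_openPartialHomeomorph {f : Euc n → M} {S : Set (Euc n)} (hS : IsOpen S)
    (hf : ContMDiffOn (𝓡 n) (𝓡 n) ∞ f S) (hinj : Set.InjOn f S)
    (himm : ∀ x ∈ S, Function.Injective (mfderiv (𝓡 n) (𝓡 n) f x)) :
    ∃ e : OpenPartialHomeomorph (Euc n) M, e.source = S ∧ (∀ x, e x = f x) ∧ e.target = f '' S ∧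
      ContMDiffOn (𝓡 n) (𝓡 n) ∞ e.symm e.target := by
  have hat : ∀ x ∈ S, ContMDiffAt (𝓡 n) (𝓡 n) ∞ f x := fun x hx =>
    hf.contMDiffAt (hS.mem_nhds hx)
  have hopen : IsOpenMap (S.domRestrict f) := by
    rw [isOpenMap_iff_nhds_le]
    rintro ⟨x, hx⟩
    rw [Set.domRestrict_eq, ← Filter.map_map, map_nhds_subtype_val, hS.nhdsWithin_eq hx]
    exact (map_nhds_eq_of_injective_mfderiv (hat x hx) (himm x hx)).ge
  let e : OpenPartialHomeomorph (Euc n) M :=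
    OpenPartialHomeomorph.ofContinuousOpenRestrict (hinj.toPartialEquiv f S) hf.continuousOn
      hopen hS
  have he : ∀ x, e x = f x := fun x => rfl
  refine ⟨e, rfl, he, rfl, fun a ha => ContMDiffAt.contMDiffWithinAt ?_⟩
  set x := e.symm a
  have hx : x ∈ S := e.map_target ha
  have hxa : f x = a := e.right_inv ha
  set c := chartAt (Euc n) a
  have hac : a ∈ c.source := mem_chart_source _ _
  have hxc : f x ∈ c.source := hxa ▸ hac
  obtain ⟨h1, h2⟩ := injective_fderiv_chartAt_comp (hat x hx) (himm x hx) hxc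
  obtain ⟨L, hL⟩ := exists_hasFDerivAt_equiv (h1.differentiableAt (by simp)) h2
  -- Near `a` the inverse of `e` is `e'.symm ∘ c`, which reduces its smoothness to the inverse
  -- function theorem between Euclidean spaces.
  let e' := e.trans c
  have hca : c a ∈ e'.target := by
    rw [OpenPartialHomeomorph.trans_target]
    exact ⟨c.map_source hac, by simpa [c.left_inv hac] using ha⟩
  have hsymm : e'.symm (c a) = x := by
    simp [e', c.left_inv hac, x]
  have h3 : ContDiffAt ℝ ∞ e'.symm (c a) :=
    e'.contDiffAt_symm hca (by rw [hsymm]; exact hL) (by rw [hsymm]; exact h1)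
  have h4 : ContMDiffAt (𝓡 n) (𝓡 n) ∞ (e'.symm ∘ c) a :=
    ContMDiffAt.comp a h3.contMDiffAt (contMDiffAt_chartAt a hac)
  refine h4.congr_of_eventuallyEq ?_
  filter_upwards [c.open_source.mem_nhds hac] with b hb
  simp [e', c.left_inv hb]

end Inverse

/-- A linear relation that is a bijective correspondence is the graph of a linear equivalence. -/
theorem exists_linearEquiv_of_rel {V W : Type*} [AddCommGroup V] [Module ℝ V] [AddCommGroup W]
    [Module ℝ W] (R : V → W → Prop) (hadd : ∀ v v' w w', R v w → R v' w' → R (v + v') (w + w'))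
    (hsmul : ∀ (c : ℝ) v w, R v w → R (c • v) (c • w)) (hr : ∀ v, ∃ w, R v w)
    (hl : ∀ w, ∃ v, R v w) (hru : ∀ v w w', R v w → R v w' → w = w')
    (hlu : ∀ v v' w, R v w → R v' w → v = v') : ∃ Φ : V ≃ₗ[ℝ] W, ∀ v, R v (Φ v) := by
  choose F hF using hr
  let L : V →ₗ[ℝ] W :=
    { toFun := F
      map_add' := fun v v' => hru _ _ _ (hF _) (hadd _ _ _ _ (hF v) (hF v'))
      map_smul' := fun c v => hru _ _ _ (hF _) (hsmul c _ _ (hF v)) }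
  refine ⟨LinearEquiv.ofBijective L ⟨fun v v' h => ?_, fun w => ?_⟩, hF⟩
  · have h' : F v = F v' := h
    exact hlu _ _ _ (hF v) (h' ▸ hF v')
  · obtain ⟨v, hv⟩ := hl w
    exact ⟨v, hru _ _ _ (hF v) hv⟩

/-- Diffeological forms on plots that factor through other plots. -/
theorem diffForm_apply_of_eq {X : Type*} {D : DiffeologicalSpace X} {k : ℕ} (β : DiffForm D k)
    (p q : Plot D) (g : Euc p.dim → Euc q.dim) (hg : ContDiff ℝ ∞ g)
    (h : p.toFun = q.toFun ∘ g) : β.1 p = pullback g (β.1 q) := by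
  obtain ⟨m, p, hp⟩ := p
  dsimp only at g hg h
  subst h
  exact β.2.2 q m g hg

/-! ### Diffeological forms and orbifold forms on an arbitrary orbifold -/

section Orbifold

variable {n m k : ℕ} {X : Type*} [TopologicalSpace X] {A : Set (OrbifoldChart n X)}

/-- Maps from Euclidean space to `X` that lift locally to charts of the atlas `A`. -/
def LiftsLocally (A : Set (OrbifoldChart n X)) (p : Euc m → X) : Prop :=
  ∀ u : Euc m, ∃ O : Set (Euc m), IsOpen O ∧ u ∈ O ∧ ∃ U : A, ∃ f : Euc m → Euc n,
    ContDiffOn ℝ ∞ f O ∧ Set.MapsTo f O U.1.dom ∧ Set.EqOn p (U.1.toFun ∘ f) O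

theorem LiftsLocally.comp {p : Euc m → X} (hp : LiftsLocally A p) {l : ℕ} {g : Euc l → Euc m}
    (hg : ContDiff ℝ ∞ g) : LiftsLocally A (p ∘ g) := fun u => by
  obtain ⟨O, hO, hu, U, f, hf, hfm, hfp⟩ := hp (g u)
  exact ⟨g ⁻¹' O, hO.preimage hg.continuous, hu, U, f ∘ g,
    hf.comp hg.contDiffOn fun x hx => hx, fun x hx => hfm hx, fun x hx => hfp hx⟩

/-- The diffeology of all maps that lift locally to charts. -/
@[reducible] def liftDiffeology (A : Set (OrbifoldChart n X))
    (hA : ∀ x : X, ∃ U ∈ A, x ∈ U.toFun '' U.dom) : DiffeologicalSpace X where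
  plots m := {p : Euc m → X | LiftsLocally A p}
  constant_plots x := fun u => by
    obtain ⟨U, hU, y, hy, hyx⟩ := hA x
    exact ⟨Set.univ, isOpen_univ, trivial, ⟨U, hU⟩, fun _ => y, contDiffOn_const,
      fun _ _ => hy, fun _ _ => hyx.symm⟩
  plot_reparam hp hf := LiftsLocally.comp hp hf
  locality := by
    intro m p hp u
    obtain ⟨V, hV, hu, h⟩ := hp u
    -- The hypothesis concerns only maps from whole Euclidean spaces into `V`. It is applied to
    -- `ballMap`, and the lift so obtained is carried back to the ball by `ballInv`.
    obtain ⟨r, hr, hrV⟩ := Metric.isOpen_iff.1 hV u hu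
    obtain ⟨O, hO, h0, U, f, hf, hfm, hfp⟩ :=
      h (fun x => hrV (ballMap_mem hr x)) (contDiff_ballMap u r) 0
    have hB : ContDiffOn ℝ ∞ (ballInv u r) (Metric.ball u r) := contDiffOn_ballInv u r
    refine ⟨Metric.ball u r ∩ ballInv u r ⁻¹' O,
      hB.continuousOn.isOpen_inter_preimage Metric.isOpen_ball hO,
      ⟨Metric.mem_ball_self hr, ?_⟩, U, f ∘ ballInv u r,
      hf.comp (hB.mono Set.inter_subset_left) fun x hx => hx.2, fun x hx => hfm hx.2,
      fun x hx => ?_⟩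
    · have h1 := ballInv_ballMap u r 0
      rw [ballMap_zero] at h1
      simpa [h1] using h0
    · have h2 := hfp hx.2
      simpa [Function.comp_def, ballMap_ballInv hx.1] using h2

/-- The generated diffeology is the smallest one that contains the generators, and `liftDiffeology`
contains them. -/
theorem liftsLocally_of_plot (hA : ∀ x : X, ∃ U ∈ A, x ∈ U.toFun '' U.dom) {p : Euc m → X}
    (hp : p ∈ (orbifoldDiffeology A).plots m) : LiftsLocally A p := by
  refine hp (liftDiffeology A hA) ?_
  rintro ⟨l, q⟩ ⟨U, hU, f, hf, hfm, hq⟩ u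
  dsimp only at f hf hfm hq
  subst hq
  exact ⟨Set.univ, isOpen_univ, trivial, ⟨U, hU⟩, f, hf.contDiffOn, fun x _ => hfm x,
    fun x _ => rfl⟩

theorem plot_of_lift (U : A) {f : Euc m → Euc n} (hf : ContDiff ℝ ∞ f)
    (hfm : ∀ u, f u ∈ U.1.dom) : U.1.toFun ∘ f ∈ (orbifoldDiffeology A).plots m :=
  DiffeologicalSpace.isPlot_generatedFrom_of_mem (g := {p | ∃ U ∈ A, ∃ f : Euc p.1 → Euc n,
    ContDiff ℝ ∞ f ∧ (∀ u, f u ∈ U.dom) ∧ p.2 = U.toFun ∘ f}) ⟨U.1, U.2, f, hf, hfm, rfl⟩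

theorem OrbifoldChart.toFun_group (U : OrbifoldChart n X) {γ : Equiv.Perm (Euc n)}
    (hγ : γ ∈ U.group) {x : Euc n} (hx : x ∈ U.dom) : U.toFun (γ x) = U.toFun x :=
  ((U.toFun_eq_iff x hx _ (U.mem_dom hγ hx)).2 ⟨γ, hγ, rfl⟩).symm

/-- Two lifts of a map to the same chart pull back invariant forms to the same form. -/
theorem pullback_eq_of_lifts (U : OrbifoldChart n X) {s : Euc n → Alt n k}
    (hs : ContDiffOn ℝ ∞ s U.dom) (hi : ∀ γ ∈ U.group, Set.EqOn (pullback γ s) s U.dom)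
    {O : Set (Euc m)} (hO : IsOpen O) {f g : Euc m → Euc n} (hf : ContDiffOn ℝ ∞ f O)
    (hg : ContDiffOn ℝ ∞ g O) (hfm : Set.MapsTo f O U.dom) (hgm : Set.MapsTo g O U.dom)
    (h : ∀ x ∈ O, U.toFun (f x) = U.toFun (g x)) :
    Set.EqOn (pullback f s) (pullback g s) O := by
  have := U.finite_group
  have hat : ∀ γ : U.group, ∀ x ∈ O, ContDiffAt ℝ ∞ γ.1 (f x) := fun γ x hx =>
    (U.smooth γ γ.2).contDiffAt (U.isOpen_dom.mem_nhds (hfm hx))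
  -- The group element carrying `f x` to `g x` may change from point to point; this reduces to
  -- points near which a single one works.
  refine eqOn_of_finite_cover hO
    (contDiffOn_pullback hO U.isOpen_dom hs hf hfm).continuousOn
    (contDiffOn_pullback hO U.isOpen_dom hs hg hgm).continuousOn (ι := U.group)
    (f := fun γ => γ.1 ∘ f) hg.continuousOn (fun γ => ?_) (fun x hx => ?_) fun γ x hx hγ => ?_
  · exact (U.smooth γ γ.2).continuousOn.comp hf.continuousOn hfm
  · obtain ⟨γ, hγ, e⟩ := (U.toFun_eq_iff _ (hfm hx) _ (hgm hx)).1 (h x hx)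
    exact ⟨⟨γ, hγ⟩, e⟩
  · rw [← pullback_congr_map hγ, pullback_comp_apply ((hat γ x hx).differentiableAt (by simp))
      ((hf.contDiffAt (hO.mem_nhds hx)).differentiableAt (by simp))]
    exact pullback_congr (hi γ γ.2 (hfm hx)).symm

theorem OrbifoldChart.IsChartEmbedding.exists_openPartialHomeomorph {W U : OrbifoldChart n X}
    {l : Euc n → Euc n} (hl : W.IsChartEmbedding U l) :
    ∃ e : OpenPartialHomeomorph (Euc n) (Euc n), e.source = W.dom ∧ (∀ x, e x = l x) ∧
      e.target = l '' W.dom ∧ ContDiffOn ℝ ∞ e.symm e.target := by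
  obtain ⟨e, h1, h2, h3, h4⟩ := OrbForms.exists_openPartialHomeomorph W.isOpen_dom
    (contMDiffOn_iff_contDiffOn.2 hl.contDiffOn) (Set.injOn_iff_injective.2 hl.isEmbedding.injective)
    fun x hx => by rw [mfderiv_eq_fderiv]; exact hl.immersive x hx
  exact ⟨e, h1, h2, h3, contMDiffOn_iff_contDiffOn.1 h4⟩

/-- Applying the compatibility of orbifold forms to the embeddings `l ∘ γ` and `l` makes the form
induced on `W` invariant under `W.group`, although `W` need not belong to the atlas. -/
theorem OrbifoldChart.IsChartEmbedding.comp_group {W U : OrbifoldChart n X}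
    {l : Euc n → Euc n} (hl : W.IsChartEmbedding U l) {γ : Equiv.Perm (Euc n)}
    (hγ : γ ∈ W.group) : W.IsChartEmbedding U (l ∘ γ) := by
  have hm : Set.MapsTo γ W.dom W.dom := fun x hx => W.mem_dom hγ hx
  have hsm : ∀ δ ∈ W.group, ∀ x ∈ W.dom, DifferentiableAt ℝ δ x := fun δ hδ x hx =>
    ((W.smooth δ hδ).contDiffAt (W.isOpen_dom.mem_nhds hx)).differentiableAt (by simp)
  have hinv : γ⁻¹ ∈ W.group := W.group.inv_mem hγ
  refine ⟨hl.mapsTo.comp hm, hl.contDiffOn.comp (W.smooth γ hγ) hm, ?_, fun x hx => ?_,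
    fun x hx => ?_⟩
  · have h1 : Continuous (hm.restrict γ W.dom W.dom) :=
      (W.smooth γ hγ).continuousOn.mapsToRestrict hm
    have hm' : Set.MapsTo (γ⁻¹ : Equiv.Perm (Euc n)) W.dom W.dom := fun x hx => W.mem_dom hinv hx
    have h2 : Continuous (hm'.restrict _ W.dom W.dom) :=
      (W.smooth _ hinv).continuousOn.mapsToRestrict hm'
    have h3 : IsEmbedding (hm.restrict γ W.dom W.dom) :=
      IsEmbedding.of_leftInverse (f := hm'.restrict _ W.dom W.dom)
        (fun x => Subtype.ext (by simp)) h2 h1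
    exact hl.isEmbedding.comp h3
  · have hd : DifferentiableAt ℝ l (γ x) :=
      (hl.contDiffOn.contDiffAt (W.isOpen_dom.mem_nhds (hm hx))).differentiableAt (by simp)
    rw [fderiv_comp x hd (hsm γ hγ x hx)]
    refine (hl.immersive _ (hm hx)).comp ?_
    have h4 : HasFDerivAt ((γ⁻¹ : Equiv.Perm (Euc n)) ∘ γ)
        ((fderiv ℝ (γ⁻¹ : Equiv.Perm (Euc n)) (γ x)).comp (fderiv ℝ γ x)) x :=
      (hsm _ hinv _ (hm hx)).hasFDerivAt.comp x (hsm γ hγ x hx).hasFDerivAt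
    have h5 : HasFDerivAt ((γ⁻¹ : Equiv.Perm (Euc n)) ∘ γ) (ContinuousLinearMap.id ℝ (Euc n)) x :=
      (hasFDerivAt_id x).congr_of_eventuallyEq (.of_forall fun y => by simp)
    have h6 := h4.unique h5
    intro u v huv
    have h7 := fun z => DFunLike.congr_fun h6 z
    simp only [ContinuousLinearMap.comp_apply, ContinuousLinearMap.id_apply] at h7
    exact (h7 u).symm.trans ((congrArg _ huv).trans (h7 v))
  · rw [Function.comp_apply, hl.comm _ (hm hx), W.toFun_group hγ hx]

/-- Since `f x` has the same image in `X` as some point `l w`, a group element `γ` of `U` carries it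
there. Near `x` the map `γ ∘ f` then stays in the open image of `l`, where `l` can be inverted. -/
theorem OrbifoldChart.IsChartEmbedding.exists_lift {W U : OrbifoldChart n X} {l : Euc n → Euc n}
    (hl : W.IsChartEmbedding U l) {O : Set (Euc m)} (hO : IsOpen O) {f : Euc m → Euc n}
    (hf : ContDiffOn ℝ ∞ f O) (hfm : Set.MapsTo f O U.dom) {x : Euc m} (hx : x ∈ O)
    (hxW : U.toFun (f x) ∈ W.toFun '' W.dom) :
    ∃ γ ∈ U.group, ∃ O' ⊆ O, IsOpen O' ∧ x ∈ O' ∧ ∃ f' : Euc m → Euc n, ContDiffOn ℝ ∞ f' O' ∧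
      Set.MapsTo f' O' W.dom ∧ ∀ y ∈ O', l (f' y) = γ (f y) := by
  obtain ⟨e, hes, hel, het, hsymm⟩ := hl.exists_openPartialHomeomorph
  obtain ⟨w, hw, hwx⟩ := hxW
  have h1 : U.toFun (f x) = U.toFun (l w) := by rw [hl.comm w hw, hwx]
  obtain ⟨γ, hγ, hγx⟩ := (U.toFun_eq_iff _ (hfm hx) _ (hl.mapsTo hw)).1 h1
  have hγf : ContDiffOn ℝ ∞ (γ ∘ f) O := (U.smooth γ hγ).comp hf hfm
  refine ⟨γ, hγ, O ∩ (γ ∘ f) ⁻¹' e.target, Set.inter_subset_left,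
    hγf.continuousOn.isOpen_inter_preimage hO e.open_target, ⟨hx, ?_⟩, e.symm ∘ γ ∘ f,
    hsymm.comp (hγf.mono Set.inter_subset_left) fun y hy => hy.2, fun y hy => ?_, fun y hy => ?_⟩
  · rw [Set.mem_preimage, Function.comp_apply, hγx, het]
    exact ⟨w, hw, rfl⟩
  · rw [← hes]
    exact e.map_target hy.2
  · rw [← hel]
    exact e.right_inv hy.2

/-- Lifts of a map to two charts pull back an orbifold form to the same form. -/
theorem orbifoldForm_pullback_eq (hA : IsOrbifoldAtlas A) (s : OrbifoldForm A k) (U V : A)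
    {O : Set (Euc m)} (hO : IsOpen O) {f g : Euc m → Euc n} (hf : ContDiffOn ℝ ∞ f O)
    (hg : ContDiffOn ℝ ∞ g O) (hfm : Set.MapsTo f O U.1.dom) (hgm : Set.MapsTo g O V.1.dom)
    (h : ∀ x ∈ O, U.1.toFun (f x) = V.1.toFun (g x)) :
    Set.EqOn (pullback f (s.1 U)) (pullback g (s.1 V)) O := fun x hx => by
  obtain ⟨hs, -, hi, hc⟩ := s.2
  -- Both lifts are replaced near `x` by lifts `f'`, `g'` to one chart `W`, at the cost of group
  -- elements `γ`, `δ` that do not affect the pullbacks.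
  obtain ⟨W, -, hxW, ⟨l, hl⟩, l', hl'⟩ := hA.compatible U U.2 V V.2 (U.1.toFun (f x))
    ⟨⟨f x, hfm hx, rfl⟩, ⟨g x, hgm hx, (h x hx).symm⟩⟩
  obtain ⟨γ, hγ, O₁, hO₁O, hO₁, hx₁, f', hf', hfm', hlf⟩ := hl.exists_lift hO hf hfm hx hxW
  obtain ⟨δ, hδ, O₂, hO₂O, hO₂, hx₂, g', hg', hgm', hlg⟩ :=
    hl'.exists_lift hO hg hgm hx (h x hx ▸ hxW)
  -- the pullback of a form on a chart containing `W` in terms of the lift to `W`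
  have key : ∀ (U : A) (l : Euc n → Euc n), W.IsChartEmbedding U.1 l → ∀ γ ∈ U.1.group,
      ∀ f : Euc m → Euc n, ContDiffAt ℝ ∞ f x → f x ∈ U.1.dom → ∀ (f' : Euc m → Euc n)
        (O' : Set (Euc m)), IsOpen O' → x ∈ O' → ContDiffOn ℝ ∞ f' O' →
        Set.MapsTo f' O' W.dom → (∀ y ∈ O', l (f' y) = γ (f y)) →
        pullback f (s.1 U) x = pullback f' (pullback l (s.1 U)) x := by
    intro U l hl γ hγ f hf hfx f' O' hO' hx' hf' hfm' hlf
    have hγf : ContDiffAt ℝ ∞ γ (f x) :=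
      (U.1.smooth γ hγ).contDiffAt (U.1.isOpen_dom.mem_nhds hfx)
    have hl1 : ContDiffAt ℝ ∞ l (f' x) :=
      hl.contDiffOn.contDiffAt (W.isOpen_dom.mem_nhds (hfm' hx'))
    rw [← pullback_comp_apply (hl1.differentiableAt (by simp))
      ((hf'.contDiffAt (hO'.mem_nhds hx')).differentiableAt (by simp))]
    have h1 : l ∘ f' =ᶠ[𝓝 x] γ ∘ f := by
      filter_upwards [hO'.mem_nhds hx'] with y hy using hlf y hy
    rw [pullback_congr_map h1, pullback_comp_apply (hγf.differentiableAt (by simp))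
      (hf.differentiableAt (by simp))]
    exact pullback_congr (hi U γ hγ hfx).symm
  rw [key U l hl γ hγ f (hf.contDiffAt (hO.mem_nhds hx)) (hfm hx) f' O₁ hO₁ hx₁ hf' hfm' hlf,
    key V l' hl' δ hδ g (hg.contDiffAt (hO.mem_nhds hx)) (hgm hx) g' O₂ hO₂ hx₂ hg' hgm' hlg]
  have hWs : ContDiffOn ℝ ∞ (pullback l (s.1 U)) W.dom :=
    contDiffOn_pullback W.isOpen_dom U.1.isOpen_dom (hs U) hl.contDiffOn hl.mapsTo
  have hWi : ∀ ε ∈ W.group, Set.EqOn (pullback ε (pullback l (s.1 U))) (pullback l (s.1 U))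
      W.dom := fun ε hε y hy => by
    rw [← hc U U W (l ∘ ε) l (hl.comp_group hε) hl hy]
    exact (pullback_comp_apply ((hl.contDiffOn.contDiffAt
      (W.isOpen_dom.mem_nhds (W.mem_dom hε hy))).differentiableAt (by simp))
      (((W.smooth ε hε).contDiffAt (W.isOpen_dom.mem_nhds hy)).differentiableAt (by simp))).symm
  have h3 : pullback g' (pullback l' (s.1 V)) x = pullback g' (pullback l (s.1 U)) x :=
    pullback_congr (hc U V W l l' hl hl' (hgm' hx₂)).symm
  rw [h3]
  refine pullback_eq_of_lifts W hWs hWi (hO₁.inter hO₂) (hf'.mono Set.inter_subset_left)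
    (hg'.mono Set.inter_subset_right) (hfm'.mono_left Set.inter_subset_left)
    (hgm'.mono_left Set.inter_subset_right) (fun y hy => ?_) ⟨hx₁, hx₂⟩
  rw [← hl.comm _ (hfm' hy.1), ← hl'.comm _ (hgm' hy.2), hlf y hy.1, hlg y hy.2,
    U.1.toFun_group hγ (hfm (hO₁O hy.1)), V.1.toFun_group hδ (hgm (hO₂O hy.2)), h y (hO₁O hy.1)]

/-- The plot that parametrises the image of a chart. -/
noncomputable def chartPlot (U : A) : Plot (orbifoldDiffeology A) :=
  ⟨n, U.1.toFun ∘ ballMap U.1.center U.1.radius,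
    plot_of_lift U (contDiff_ballMap _ _) fun u => ballMap_mem U.1.radius_pos u⟩

/-- The form on the ball of `U` is the value of `β` on `chartPlot U`, carried back from Euclidean
space by `ballInv`. Compatibility holds because two factorisations of one plot through charts must
give the same value of `β`. -/
theorem exists_isChartPullback_right (β : DiffForm (orbifoldDiffeology A) k) :
    ∃ s : OrbifoldForm A k, IsChartPullback β s := by
  let t : A → Euc n → Alt n k := fun U =>
    pullback (ballInv U.1.center U.1.radius) (β.1 (chartPlot U))
  let s : A → Euc n → Alt n k := fun U => U.1.dom.indicator (t U)
  have hinv : ∀ U : A, ContDiffOn ℝ ∞ (ballInv U.1.center U.1.radius) U.1.dom := fun U =>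
    contDiffOn_ballInv _ _
  have hst : ∀ U : A, Set.EqOn (s U) (t U) U.1.dom := fun U x hx => Set.indicator_of_mem hx _
  have hpull : ∀ (U : A) (p : Plot (orbifoldDiffeology A)) (f : Euc p.dim → Euc n),
      ContDiff ℝ ∞ f → (∀ u, f u ∈ U.1.dom) → p.toFun = U.1.toFun ∘ f →
      β.1 p = pullback f (s U) := by
    intro U p f hf hfm hp
    have hg : ContDiff ℝ ∞ (ballInv U.1.center U.1.radius ∘ f) :=
      contDiffOn_univ.1 ((hinv U).comp hf.contDiffOn fun u _ => hfm u)
    have h1 := diffForm_apply_of_eq β p (chartPlot U) (ballInv U.1.center U.1.radius ∘ f) hg (by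
      rw [hp]
      funext u
      exact congrArg U.1.toFun (ballMap_ballInv (hfm u)).symm)
    rw [h1]
    funext u
    refine (pullback_comp_apply (((hinv U).contDiffAt
      (U.1.isOpen_dom.mem_nhds (hfm u))).differentiableAt (by simp))
      (hf.differentiable (by simp) u)).trans ?_
    exact pullback_congr (hst U (hfm u)).symm
  -- two maps from an open ball with the same composite to `X` pull back to the same form
  have hcompat : ∀ (U V W : OrbifoldChart n X) (hU : U ∈ A) (hV : V ∈ A) (l l' : Euc n → Euc n),
      ContDiffOn ℝ ∞ l W.dom → ContDiffOn ℝ ∞ l' W.dom → Set.MapsTo l W.dom U.dom →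
      Set.MapsTo l' W.dom V.dom → (∀ x ∈ W.dom, U.toFun (l x) = V.toFun (l' x)) →
      Set.EqOn (pullback l (s ⟨U, hU⟩)) (pullback l' (s ⟨V, hV⟩)) W.dom := by
    intro U V W hU hV l l' hl hl' hlm hlm' h
    refine eq_of_pullback_ballMap W.radius_pos ?_
    have hb : ContDiff ℝ ∞ (ballMap W.center W.radius) := contDiff_ballMap _ _
    have hbm : ∀ u, ballMap W.center W.radius u ∈ W.dom := ballMap_mem W.radius_pos
    have h1 : ∀ l : Euc n → Euc n, ContDiffOn ℝ ∞ l W.dom →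
        ContDiff ℝ ∞ (l ∘ ballMap W.center W.radius) := fun l hl =>
      contDiffOn_univ.1 (hl.comp hb.contDiffOn fun u _ => hbm u)
    have h2 : ∀ (l : Euc n → Euc n) (w : Euc n → Alt n k), ContDiffOn ℝ ∞ l W.dom →
        pullback (ballMap W.center W.radius) (pullback l w) =
          pullback (l ∘ ballMap W.center W.radius) w := fun l w hl => funext fun u =>
      (pullback_comp_apply ((hl.contDiffAt (W.isOpen_dom.mem_nhds (hbm u))).differentiableAt
        (by simp)) (hb.differentiable (by simp) u)).symm
    rw [h2 l _ hl, h2 l' _ hl']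
    -- Both sides are the value of `β` on one and the same plot, which factors through `U` by `l`
    -- and through `V` by `l'`.
    rw [← hpull ⟨U, hU⟩ ⟨n, _, plot_of_lift ⟨U, hU⟩ (h1 l hl) fun u => hlm (hbm u)⟩ _ (h1 l hl)
      (fun u => hlm (hbm u)) rfl]
    exact hpull ⟨V, hV⟩ ⟨n, _, plot_of_lift ⟨U, hU⟩ (h1 l hl) fun u => hlm (hbm u)⟩ _ (h1 l' hl')
      (fun u => hlm' (hbm u)) (funext fun u => h _ (hbm u))
  refine ⟨⟨s, fun U => ?_, fun U x hx => Set.indicator_of_notMem hx _, fun U γ hγ => ?_,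
    fun U V W l l' hl hl' => hcompat U V W U.2 V.2 l l' hl.contDiffOn hl'.contDiffOn hl.mapsTo
      hl'.mapsTo fun x hx => (hl.comm x hx).trans (hl'.comm x hx).symm⟩, hpull⟩
  · exact (contDiffOn_pullback U.1.isOpen_dom isOpen_univ (β.2.1 _).contDiffOn (hinv U)
      fun _ _ => trivial).congr (hst U)
  -- Invariance is compatibility of the two maps `γ` and `id` from the ball of `U` to itself.
  · have h := hcompat U U U U.2 U.2 γ id (U.1.smooth γ hγ) contDiffOn_id
      (fun x hx => U.1.mem_dom hγ hx) (fun x hx => hx) fun x hx => U.1.toFun_group hγ hx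
    rwa [pullback_id] at h

/-- The value on a plot at `u` uses a local lift chosen for `u`. By `orbifoldForm_pullback_eq` any
other lift gives the same value, so near `u` the form is the pullback along a single lift; this
yields smoothness and naturality. -/
theorem exists_isChartPullback_left (hA : IsOrbifoldAtlas A) (s : OrbifoldForm A k) :
    ∃ β : DiffForm (orbifoldDiffeology A) k, IsChartPullback β s := by
  choose O hO hu U f hf hfm hfp using fun (p : Plot (orbifoldDiffeology A)) =>
    liftsLocally_of_plot hA.covers p.isPlot
  let α : ∀ p : Plot (orbifoldDiffeology A), Euc p.dim → Alt p.dim k := fun p u =>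
    pullback (f p u) (s.1 (U p u)) u
  have hα : ∀ (p : Plot (orbifoldDiffeology A)) (V : A) (S : Set (Euc p.dim)) (hS : IsOpen S)
      (g : Euc p.dim → Euc n), ContDiffOn ℝ ∞ g S → Set.MapsTo g S V.1.dom →
      Set.EqOn p.toFun (V.1.toFun ∘ g) S → Set.EqOn (α p) (pullback g (s.1 V)) S := by
    intro p V S hS g hg hgm hgp x hx
    refine orbifoldForm_pullback_eq hA s (U p x) V ((hO p x).inter hS) ((hf p x).mono Set.inter_subset_left)
      (hg.mono Set.inter_subset_right) ((hfm p x).mono_left Set.inter_subset_left)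
      (hgm.mono_left Set.inter_subset_right) (fun y hy => ?_) ⟨hu p x, hx⟩
    exact (hfp p x hy.1).symm.trans (hgp hy.2)
  refine ⟨⟨α, fun p => contDiff_iff_contDiffAt.2 fun u => ?_, fun p m h hh => funext fun u => ?_⟩,
    fun V p g hg hgm hp => funext fun u =>
      hα p V Set.univ isOpen_univ g hg.contDiffOn (fun u _ => hgm u) (fun u _ => congrFun hp u)
        trivial⟩
  · have h1 := hα p (U p u) (O p u) (hO p u) (f p u) (hf p u) (hfm p u) (hfp p u)
    refine ContDiffAt.congr_of_eventuallyEq ?_ (h1.eventuallyEq_of_mem ((hO p u).mem_nhds (hu p u)))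
    exact (contDiffOn_pullback (hO p u) (U p u).1.isOpen_dom (s.2.1 _) (hf p u)
      (hfm p u)).contDiffAt ((hO p u).mem_nhds (hu p u))
  · have h1 := hα (p.reparam h hh) (U p (h u)) (h ⁻¹' O p (h u))
      ((hO p (h u)).preimage hh.continuous) (f p (h u) ∘ h)
      ((hf p (h u)).comp hh.contDiffOn fun x hx => hx) (fun x hx => hfm p (h u) hx)
      (fun x hx => hfp p (h u) hx) (hu p (h u))
    exact h1.trans (pullback_comp_apply (((hf p (h u)).contDiffAt
      ((hO p (h u)).mem_nhds (hu p (h u)))).differentiableAt (by simp))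
      (hh.differentiable (by simp) u))

theorem isChartPullback_right_unique {β : DiffForm (orbifoldDiffeology A) k}
    {s s' : OrbifoldForm A k} (h : IsChartPullback β s) (h' : IsChartPullback β s') : s = s' := by
  refine Subtype.ext (funext fun U => funext fun x => ?_)
  by_cases hx : x ∈ U.1.dom
  · refine eq_of_pullback_ballMap U.1.radius_pos ?_ hx
    have hm : ∀ u, ballMap U.1.center U.1.radius u ∈ U.1.dom := ballMap_mem U.1.radius_pos
    refine (h U (chartPlot U) _ (contDiff_ballMap _ _) hm rfl).symm.trans ?_
    exact h' U (chartPlot U) _ (contDiff_ballMap _ _) hm rfl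
  · rw [s.2.2.1 U x hx, s'.2.2.1 U x hx]

/-- Restricted to a small ball, any plot factors through a chart, where its value is prescribed by
`s`. -/
theorem isChartPullback_left_unique (hA : IsOrbifoldAtlas A)
    {β β' : DiffForm (orbifoldDiffeology A) k} {s : OrbifoldForm A k} (h : IsChartPullback β s)
    (h' : IsChartPullback β' s) : β = β' := by
  refine Subtype.ext (funext fun p => funext fun u => ?_)
  obtain ⟨O, hO, hu, U, f, hf, hfm, hfp⟩ := liftsLocally_of_plot hA.covers p.isPlot u
  obtain ⟨r, hr, hrO⟩ := Metric.isOpen_iff.1 hO u hu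
  have hb : ContDiff ℝ ∞ (ballMap u r) := contDiff_ballMap _ _
  have hbO : ∀ v, ballMap u r v ∈ O := fun v => hrO (ballMap_mem hr v)
  have hfb : ContDiff ℝ ∞ (f ∘ ballMap u r) :=
    contDiffOn_univ.1 (hf.comp hb.contDiffOn fun v _ => hbO v)
  refine eq_of_pullback_ballMap hr ?_ (Metric.mem_ball_self hr)
  rw [← β.2.2 p _ _ hb, ← β'.2.2 p _ _ hb,
    h U (p.reparam _ hb) _ hfb (fun v => hfm (hbO v)) (funext fun v => hfp (hbO v))]
  exact (h' U (p.reparam _ hb) _ hfb (fun v => hfm (hbO v)) (funext fun v => hfp (hbO v))).symm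

theorem IsChartPullback.add {D : DiffeologicalSpace X} {β β' : DiffForm D k}
    {s s' : OrbifoldForm A k} (h : IsChartPullback β s) (h' : IsChartPullback β' s') :
    IsChartPullback (β + β') (s + s') := fun U p f hf hfm hp => by
  change β.1 p + β'.1 p = _
  rw [h U p f hf hfm hp, h' U p f hf hfm hp]
  rfl

theorem IsChartPullback.smul {D : DiffeologicalSpace X} {β : DiffForm D k}
    {s : OrbifoldForm A k} (c : ℝ) (h : IsChartPullback β s) :
    IsChartPullback (c • β) (c • s) := fun U p f hf hfm hp => by
  change c • β.1 p = _
  rw [h U p f hf hfm hp]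
  rfl

theorem IsChartPullback.diffD {D : DiffeologicalSpace X} {β : DiffForm D k}
    {s : OrbifoldForm A k} (h : IsChartPullback β s) :
    IsChartPullback (diffD β) (orbD s) := fun U p f hf hfm hp => by
  change extDeriv (β.1 p) = _
  rw [h U p f hf hfm hp]
  funext u
  rw [extDeriv_pullback_apply ((s.2.1 U).contDiffAt (U.1.isOpen_dom.mem_nhds (hfm u)))
    hf.contDiffAt]
  exact pullback_congr (Set.indicator_of_mem (hfm u) _).symm

/-- Pullback along the charts is an isomorphism from the diffeological forms to the orbifold
forms. -/
theorem exists_equiv_orbifoldForm (hA : IsOrbifoldAtlas A) {D : DiffeologicalSpace X}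
    (hD : orbifoldDiffeology A = D) :
    ∃ Φ : ∀ k : ℕ, DiffForm D k ≃ₗ[ℝ] OrbifoldForm A k,
      (∀ k β, IsChartPullback β (Φ k β)) ∧ ∀ k β, Φ (k + 1) (diffD β) = orbD (Φ k β) := by
  subst hD
  choose Φ hΦ using fun k => exists_linearEquiv_of_rel
    (fun (β : DiffForm (orbifoldDiffeology A) k) (s : OrbifoldForm A k) => IsChartPullback β s)
    (fun _ _ _ _ => IsChartPullback.add) (fun c _ _ => IsChartPullback.smul c)
    exists_isChartPullback_right (exists_isChartPullback_left hA)
    (fun _ _ _ => isChartPullback_right_unique) fun _ _ _ => isChartPullback_left_unique hA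
  exact ⟨Φ, hΦ, fun k β => isChartPullback_right_unique (hΦ _ _) (hΦ k β).diffD⟩

end Orbifold

/-! ### Pullbacks of forms on manifolds -/

section Manifold

variable {n m l k : ℕ} {M : Type*} [TopologicalSpace M]
  [ChartedSpace (EuclideanSpace ℝ (Fin n)) M]

theorem mpullback_comp_apply {w : ∀ x : M, TangentSpace (𝓡 n) x [⋀^Fin k]→L[ℝ] ℝ} {q : Euc m → M}
    {f : Euc l → Euc m} {u : Euc l} (hq : MDifferentiableAt (𝓡 m) (𝓡 n) q (f u))
    (hf : DifferentiableAt ℝ f u) : mpullback (q ∘ f) w u = pullback f (mpullback q w) u := by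
  have h : mfderiv (𝓡 l) (𝓡 n) (q ∘ f) u =
      (mfderiv (𝓡 m) (𝓡 n) q (f u)).comp (fderiv ℝ f u) := by
    rw [mfderiv_comp u hq hf.mdifferentiableAt, mfderiv_eq_fderiv]
    rfl
  simp only [mpullback, pullback, h]
  rfl

theorem mpullback_congr_map {w : ∀ x : M, TangentSpace (𝓡 n) x [⋀^Fin k]→L[ℝ] ℝ} {q q' : Euc m → M}
    {u : Euc m} (h : q =ᶠ[𝓝 u] q') : mpullback q w u = mpullback q' w u := by
  have h1 := h.mfderiv_eq (I := 𝓡 m) (I' := 𝓡 n)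
  have h2 := h.eq_of_nhds
  -- The tangent spaces at `q u` and `q' u` are formally different types that both unfold to `Euc
  -- n`. In this non-dependent form the equalities can be substituted.
  have key : ∀ (v : M → Alt n k) (a b : M) (L L' : Euc m →L[ℝ] Euc n), a = b → L = L' →
      (v a).compContinuousLinearMap L = (v b).compContinuousLinearMap L' := by
    rintro v a _ L _ rfl rfl
    rfl
  exact key w _ _ _ _ h2 h1

theorem eq_of_mpullback_eq {w η : ∀ x : M, TangentSpace (𝓡 n) x [⋀^Fin k]→L[ℝ] ℝ} {q : Euc n → M}
    {u : Euc n} (hq : Function.Injective (mfderiv (𝓡 n) (𝓡 n) q u))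
    (h : mpullback q w u = mpullback q η u) : w (q u) = η (q u) :=
  compContinuousLinearMap_injective (E := Euc n) (F := Euc n)
    (bijective_of_injective (L := mfderiv (𝓡 n) (𝓡 n) q u) hq).2 h

/-- The pullback of a form along `q`, in terms of a local parametrisation `e` of the manifold. -/
theorem mpullback_eq_pullback (w : ∀ x : M, TangentSpace (𝓡 n) x [⋀^Fin k]→L[ℝ] ℝ)
    {e : OpenPartialHomeomorph (Euc n) M} (he : ContMDiffOn (𝓡 n) (𝓡 n) ∞ e e.source)
    (he' : ContMDiffOn (𝓡 n) (𝓡 n) ∞ e.symm e.target) {q : Euc m → M} {u : Euc m}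
    (hq : ContMDiffAt (𝓡 m) (𝓡 n) ∞ q u) (hu : q u ∈ e.target) :
    ContDiffAt ℝ ∞ (e.symm ∘ q) u ∧ mpullback q w u = pullback (e.symm ∘ q) (mpullback e w) u := by
  have h1 : ContMDiffAt (𝓡 m) (𝓡 n) ∞ (e.symm ∘ q) u :=
    (he'.contMDiffAt (e.open_target.mem_nhds hu)).comp u hq
  have h2 : q =ᶠ[𝓝 u] e ∘ (e.symm ∘ q) := by
    filter_upwards [hq.continuousAt (e.open_target.mem_nhds hu)] with v hv
    exact (e.right_inv hv).symm
  refine ⟨h1.contDiffAt, (mpullback_congr_map h2).trans (mpullback_comp_apply ?_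
    (h1.contDiffAt.differentiableAt (by simp)))⟩
  exact (he.contMDiffAt (e.open_source.mem_nhds (e.map_target hu))).mdifferentiableAt (by simp)

variable {Γ : Type*} [Group Γ] [MulAction Γ M]

theorem mpullback_smul (hΓ : ∀ γ : Γ, ContMDiff (𝓡 n) (𝓡 n) ∞ (fun x : M => γ • x))
    (w : InvariantForm n M Γ k) (γ : Γ) {q : Euc m → M} {u : Euc m}
    (hq : MDifferentiableAt (𝓡 m) (𝓡 n) q u) :
    mpullback (fun v => γ • q v) w.1 u = mpullback q w.1 u := by
  have h : mfderiv (𝓡 m) (𝓡 n) (fun v => γ • q v) u =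
      (mfderiv (𝓡 n) (𝓡 n) (fun y : M => γ • y) (q u)).comp (mfderiv (𝓡 m) (𝓡 n) q u) :=
    mfderiv_comp u ((hΓ γ).mdifferentiableAt (by simp)) hq
  have h2 := w.2.2 γ (q u)
  simp only [mpullback, h]
  rw [← h2]
  rfl

variable [IsManifold (𝓡 n) ∞ M]

theorem contDiffAt_mpullback {w : ∀ x : M, TangentSpace (𝓡 n) x [⋀^Fin k]→L[ℝ] ℝ}
    (hw : IsSmoothForm w) {S : Set (Euc m)} (hS : IsOpen S) {q : Euc m → M}
    (hq : ContMDiffOn (𝓡 m) (𝓡 n) ∞ q S) {u : Euc m} (hu : u ∈ S) :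
    ContDiffAt ℝ ∞ (mpullback q w) u := by
  set c := chartAt (Euc n) (q u)
  have hc : q u ∈ c.source := mem_chart_source _ _
  have hqu := hq.contMDiffAt (hS.mem_nhds hu)
  have hsymm : ContMDiffOn (𝓡 n) (𝓡 n) ∞ c.symm c.target := contMDiffOn_chart_symm
  have hch : ContMDiffOn (𝓡 n) (𝓡 n) ∞ c c.source := contMDiffOn_chart
  have key := fun v (hv : v ∈ S) (hvc : q v ∈ c.source) =>
    mpullback_eq_pullback w (e := c.symm) hsymm hch (hq.contMDiffAt (hS.mem_nhds hv)) hvc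
  have h1 : mpullback q w =ᶠ[𝓝 u] pullback (c ∘ q) (mpullback c.symm w) := by
    filter_upwards [hS.mem_nhds hu, hqu.continuousAt (c.open_source.mem_nhds hc)] with v hv hvc
    exact (key v hv hvc).2
  refine ContDiffAt.congr_of_eventuallyEq (contDiffAt_pullback ?_ (key u hu hc).1) h1
  exact (hw c (chart_mem_atlas _ _)).contDiffAt (c.open_target.mem_nhds (c.map_source hc))

theorem contDiffOn_mpullback {w : ∀ x : M, TangentSpace (𝓡 n) x [⋀^Fin k]→L[ℝ] ℝ}
    (hw : IsSmoothForm w) {S : Set (Euc m)} (hS : IsOpen S) {q : Euc m → M}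
    (hq : ContMDiffOn (𝓡 m) (𝓡 n) ∞ q S) : ContDiffOn ℝ ∞ (mpullback q w) S :=
  fun _ hu => (contDiffAt_mpullback hw hS hq hu).contDiffWithinAt

/-- The exterior derivative of forms on manifolds is compatible with pullback. -/
theorem mpullback_mextDeriv {w : ∀ x : M, TangentSpace (𝓡 n) x [⋀^Fin k]→L[ℝ] ℝ}
    (hw : IsSmoothForm w) {S : Set (Euc m)} (hS : IsOpen S) {q : Euc m → M}
    (hq : ContMDiffOn (𝓡 m) (𝓡 n) ∞ q S) {u : Euc m} (hu : u ∈ S) :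
    mpullback q (mextDeriv w) u = extDeriv (mpullback q w) u := by
  set c := chartAt (Euc n) (q u)
  have hc : q u ∈ c.source := mem_chart_source _ _
  have hqu := hq.contMDiffAt (hS.mem_nhds hu)
  have hsymm : ContMDiffOn (𝓡 n) (𝓡 n) ∞ c.symm c.target := contMDiffOn_chart_symm
  have hch : ContMDiffOn (𝓡 n) (𝓡 n) ∞ c c.source := contMDiffOn_chart
  have key := fun v (hv : v ∈ S) (hvc : q v ∈ c.source) =>
    mpullback_eq_pullback w (e := c.symm) hsymm hch (hq.contMDiffAt (hS.mem_nhds hv)) hvc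
  have h1 : mpullback q w =ᶠ[𝓝 u] pullback (c ∘ q) (mpullback c.symm w) := by
    filter_upwards [hS.mem_nhds hu, hqu.continuousAt (c.open_source.mem_nhds hc)] with v hv hvc
    exact (key v hv hvc).2
  rw [h1.extDeriv_eq, extDeriv_pullback_apply (f := c ∘ q) (x := u)
    ((hw c (chart_mem_atlas _ _)).contDiffAt (c.open_target.mem_nhds (c.map_source hc)))
    (key u hu hc).1]
  have h2 : fderiv ℝ (c ∘ q) u =
      (mfderiv (𝓡 n) (𝓡 n) c (q u)).comp (mfderiv (𝓡 m) (𝓡 n) q u) := by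
    rw [← mfderiv_eq_fderiv, mfderiv_comp u
      ((hch.contMDiffAt (c.open_source.mem_nhds hc)).mdifferentiableAt (by simp))
      (hqu.mdifferentiableAt (by simp))]
  simp only [pullback, h2]
  rfl

/-- Two maps to `M` with the same composite to `M / Γ` pull back `Γ`-invariant forms to the same
form. -/
theorem mpullback_eq_of_mk_eq [T2Space M] [Finite Γ]
    (hΓ : ∀ γ : Γ, ContMDiff (𝓡 n) (𝓡 n) ∞ (fun x : M => γ • x)) (w : InvariantForm n M Γ k)
    {O : Set (Euc m)} (hO : IsOpen O) {f g : Euc m → M} (hf : ContMDiffOn (𝓡 m) (𝓡 n) ∞ f O)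
    (hg : ContMDiffOn (𝓡 m) (𝓡 n) ∞ g O)
    (h : ∀ x ∈ O, Quotient.mk (MulAction.orbitRel Γ M) (f x) = Quotient.mk _ (g x)) :
    Set.EqOn (mpullback f w.1) (mpullback g w.1) O := by
  refine eqOn_of_finite_cover hO (contDiffOn_mpullback w.2.1 hO hf).continuousOn
    (contDiffOn_mpullback w.2.1 hO hg).continuousOn (ι := Γ) (f := fun γ x => γ • f x)
    hg.continuousOn (fun γ => (hΓ γ).continuous.comp_continuousOn hf.continuousOn)
    (fun x hx => ?_) fun γ x hx hγ => ?_
  · exact MulAction.orbitRel_apply.1 (Quotient.exact (h x hx).symm)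
  · rw [← mpullback_congr_map hγ, mpullback_smul hΓ w γ
      ((hf.contMDiffAt (hO.mem_nhds hx)).mdifferentiableAt (by simp))]

end Manifold

/-! ### Invariant coordinates around a fixed point of a finite group -/

/-- The orthogonal projection to the range of `L`, in orthonormal coordinates. -/
theorem exists_norm_invariant_leftInverse {n : ℕ} {W : Type*} [NormedAddCommGroup W]
    [InnerProductSpace ℝ W] [FiniteDimensional ℝ W] {ι : Type*} (R : ι → W ≃ₗᵢ[ℝ] W)
    (L : Euc n →L[ℝ] W) (hL : Function.Injective L) (hR : ∀ i v, ∃ v', R i (L v) = L v') :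
    ∃ B : W →L[ℝ] Euc n, Function.Injective (B.comp L) ∧ ∀ i w, ‖B (R i w)‖ = ‖B w‖ := by
  let V : Submodule ℝ W := LinearMap.range (L : Euc n →ₗ[ℝ] W)
  have hVn : Module.finrank ℝ V = n := by
    rw [LinearMap.finrank_range_of_inj hL]
    simp
  let j : V ≃ₗᵢ[ℝ] Euc n := ((stdOrthonormalBasis ℝ V).reindex (finCongr hVn)).repr
  have hB : ∀ w, ‖j (V.orthogonalProjectionOnto w)‖ = ‖V.starProjection w‖ := fun w => by
    rw [j.norm_map]
    rfl
  refine ⟨(j.toContinuousLinearEquiv : V →L[ℝ] Euc n).comp V.orthogonalProjectionOnto, ?_, ?_⟩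
  · intro u v huv
    have h1 : V.orthogonalProjectionOnto (L u) = V.orthogonalProjectionOnto (L v) := j.injective huv
    have h2 : ∀ z, V.orthogonalProjectionOnto (L z) = ⟨L z, z, rfl⟩ := fun z =>
      V.orthogonalProjectionOnto_mem_subspace_eq_self ⟨L z, z, rfl⟩
    rw [h2, h2] at h1
    exact hL (congrArg Subtype.val h1)
  · intro i w
    -- The isometry maps `V` into itself, hence onto itself by dimension, so it commutes with the
    -- orthogonal projection to `V`.
    have hV : V.map ((R i).toLinearEquiv : W →ₗ[ℝ] W) = V := by
      refine Submodule.eq_of_le_of_finrank_eq ?_ (LinearEquiv.finrank_map_eq (R i).toLinearEquiv V)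
      rintro _ ⟨_, ⟨v, rfl⟩, rfl⟩
      obtain ⟨v', hv'⟩ := hR i v
      exact ⟨v', hv'.symm⟩
    have h1 := Submodule.starProjection_map_apply (R i) V (R i w)
    simp only [hV, LinearIsometryEquiv.symm_apply_apply] at h1
    change ‖j (V.orthogonalProjectionOnto (R i w))‖ = ‖j (V.orthogonalProjectionOnto w)‖
    rw [hB, hB, h1, (R i).norm_map]

/-- Local injectivity is the inverse function theorem; the derivative stays invertible nearby
because invertible linear maps form an open set. -/
theorem exists_isOpen_injOn {n : ℕ} {f : Euc n → Euc n} {S : Set (Euc n)} (hS : IsOpen S)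
    (hf : ContDiffOn ℝ ∞ f S) {a : Euc n} (ha : a ∈ S) (hinj : Function.Injective (fderiv ℝ f a)) :
    ∃ S' ⊆ S, IsOpen S' ∧ a ∈ S' ∧ Set.InjOn f S' ∧
      ∀ x ∈ S', Function.Injective (fderiv ℝ f x) := by
  have hfa := hf.contDiffAt (hS.mem_nhds ha)
  obtain ⟨L, hL⟩ := exists_hasFDerivAt_equiv (hfa.differentiableAt (by simp)) hinj
  let e := hfa.toOpenPartialHomeomorph f hL (by simp)
  let T : Set (Euc n →L[ℝ] Euc n) := Set.range fun L : Euc n ≃L[ℝ] Euc n => (L : Euc n →L[ℝ] Euc n)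
  have hT : IsOpen T := ContinuousLinearEquiv.isOpen
  have hc : ContinuousOn (fderiv ℝ f) S := (hf.continuousOn_fderiv_of_isOpen hS (by simp))
  refine ⟨e.source ∩ (S ∩ fderiv ℝ f ⁻¹' T), fun x hx => hx.2.1,
    e.open_source.inter (hc.isOpen_inter_preimage hS hT),
    ⟨hfa.mem_toOpenPartialHomeomorph_source hL (by simp), ha, L, hL.fderiv.symm⟩,
    e.injOn.mono fun x hx => hx.1, fun x hx => ?_⟩
  obtain ⟨L', hL'⟩ := hx.2.2
  rw [← hL']
  exact L'.injective

/-- Differentiating `h ∘ g δ = R δ ∘ h` at the fixed point shows that `R δ` preserves the range of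
the derivative of `h`. The coordinates are `h` followed by orthogonal projection to this range. -/
theorem exists_norm_invariant_coordinates_of_equivariant {n : ℕ} {W : Type*}
    [NormedAddCommGroup W] [InnerProductSpace ℝ W] [FiniteDimensional ℝ W] {G : Type*} {a : Euc n}
    {S : Set (Euc n)} (hS : IsOpen S) (ha : a ∈ S) {g : G → Euc n → Euc n}
    (hd : ∀ γ, DifferentiableAt ℝ (g γ) a) (hga : ∀ γ, g γ a = a) {h : Euc n → W}
    (hh : ContDiffOn ℝ ∞ h S) (h0 : h a = 0) (hL : Function.Injective (fderiv ℝ h a))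
    (R : G → W ≃ₗᵢ[ℝ] W) (hRh : ∀ δ, ∀ᶠ x in 𝓝 a, h (g δ x) = R δ (h x)) :
    ∃ (f : Euc n → Euc n) (S' : Set (Euc n)), S' ⊆ S ∧ IsOpen S' ∧ a ∈ S' ∧ ContDiffOn ℝ ∞ f S' ∧
      f a = 0 ∧ Set.InjOn f S' ∧ (∀ x ∈ S', Function.Injective (fderiv ℝ f x)) ∧
      ∀ δ, ∀ᶠ x in 𝓝 a, ‖f (g δ x)‖ = ‖f x‖ := by
  have hhd : DifferentiableAt ℝ h a :=
    (hh.contDiffAt (hS.mem_nhds ha)).differentiableAt (by simp)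
  have hRL : ∀ δ v, ∃ v', R δ (fderiv ℝ h a v) = fderiv ℝ h a v' := fun δ v => by
    refine ⟨fderiv ℝ (g δ) a v, ?_⟩
    have h1 : HasFDerivAt (fun x => R δ (h x))
        (((R δ).toContinuousLinearEquiv : W →L[ℝ] W).comp (fderiv ℝ h a)) a :=
      ((R δ).toContinuousLinearEquiv : W →L[ℝ] W).hasFDerivAt.comp a hhd.hasFDerivAt
    have h2 : HasFDerivAt h (fderiv ℝ h a) (g δ a) := by
      rw [hga]
      exact hhd.hasFDerivAt
    have h3 := (h2.comp a (hd δ).hasFDerivAt).congr_of_eventuallyEq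
      ((hRh δ).mono fun x hx => hx.symm)
    exact DFunLike.congr_fun (h1.unique h3) v
  obtain ⟨B, hBL, hB⟩ := exists_norm_invariant_leftInverse R (fderiv ℝ h a) hL hRL
  have hf : ContDiffOn ℝ ∞ (B ∘ h) S := B.contDiff.comp_contDiffOn hh
  have hfd : fderiv ℝ (B ∘ h) a = B.comp (fderiv ℝ h a) :=
    (B.hasFDerivAt.comp a hhd.hasFDerivAt).fderiv
  obtain ⟨S', hS'S, hS', haS', hinj, himm⟩ :=
    exists_isOpen_injOn hS hf ha (by rw [hfd]; exact hBL)
  refine ⟨B ∘ h, S', hS'S, hS', haS', hf.mono hS'S, by simp [h0], hinj, himm, fun δ => ?_⟩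
  filter_upwards [hRh δ] with x hx
  rw [Function.comp_apply, Function.comp_apply, hx, hB]

/-- Around a common fixed point `a` of a finite group of local diffeomorphisms of Euclidean space
there are coordinates `f` with `f a = 0` in which the group preserves the norm. -/
theorem exists_norm_invariant_coordinates {n : ℕ} {G : Type*} [Group G] [Finite G] {a : Euc n}
    {S : Set (Euc n)} (hS : IsOpen S) (ha : a ∈ S) (g : G → Euc n → Euc n)
    (hg : ∀ γ, ContDiffOn ℝ ∞ (g γ) S) (hga : ∀ γ, g γ a = a) (hg1 : ∀ᶠ x in 𝓝 a, g 1 x = x)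
    (hmul : ∀ γ δ, ∀ᶠ x in 𝓝 a, g γ (g δ x) = g (γ * δ) x) :
    ∃ (f : Euc n → Euc n) (S' : Set (Euc n)), S' ⊆ S ∧ IsOpen S' ∧ a ∈ S' ∧ ContDiffOn ℝ ∞ f S' ∧
      f a = 0 ∧ Set.InjOn f S' ∧ (∀ x ∈ S', Function.Injective (fderiv ℝ f x)) ∧
      ∀ δ, ∀ᶠ x in 𝓝 a, ‖f (g δ x)‖ = ‖f x‖ := by
  have := Fintype.ofFinite G
  -- Recording all translates at once turns the action of `g δ` into the permutation `γ ↦ γ * δ` of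
  -- the factors, an isometry for the `ℓ²` norm.
  let h : Euc n → PiLp 2 fun _ : G => Euc n := fun x => WithLp.toLp 2 fun γ => g γ x - a
  have happ : ∀ x γ, h x γ = g γ x - a := fun x γ => rfl
  have hh : ContDiffOn ℝ ∞ h S := contDiffOn_piLp' 2 fun γ => (hg γ).sub contDiffOn_const
  have hhd : DifferentiableAt ℝ h a :=
    (hh.contDiffAt (hS.mem_nhds ha)).differentiableAt (by simp)
  obtain ⟨R, hR⟩ : ∃ R : G → (PiLp 2 fun _ : G => Euc n) ≃ₗᵢ[ℝ] PiLp 2 fun _ : G => Euc n,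
      ∀ δ w γ, R δ w γ = w (γ * δ) :=
    ⟨fun δ => LinearIsometryEquiv.piLpCongrLeft 2 ℝ (Euc n) (Equiv.mulRight δ).symm,
      fun δ w γ => rfl⟩
  clear_value h
  refine exists_norm_invariant_coordinates_of_equivariant hS ha (h := h) (fun γ =>
    ((hg γ).contDiffAt (hS.mem_nhds ha)).differentiableAt (by simp)) hga hh ?_ ?_ R fun δ => ?_
  · ext1 γ
    rw [happ, hga, sub_self]
    rfl
  -- The component of `h` at the identity element is `x - a` near `a`, so the derivative of `h` has
  -- a left inverse.
  · let p : (PiLp 2 fun _ : G => Euc n) →L[ℝ] Euc n := PiLp.proj 2 (fun _ : G => Euc n) 1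
    have h1 : HasFDerivAt (p ∘ h) (p.comp (fderiv ℝ h a)) a :=
      p.hasFDerivAt.comp a hhd.hasFDerivAt
    have h2 : HasFDerivAt (p ∘ h) (ContinuousLinearMap.id ℝ (Euc n)) a := by
      refine ((hasFDerivAt_id a).sub_const a).congr_of_eventuallyEq ?_
      filter_upwards [hg1] with x hx
      refine (happ x 1).trans ?_
      rw [hx, id]
    have h3 := h1.unique h2
    intro u v huv
    have h4 : ∀ z, p (fderiv ℝ h a z) = z := fun z => DFunLike.congr_fun h3 z
    rw [← h4 u, ← h4 v, huv]
  · have : ∀ᶠ x in 𝓝 a, ∀ γ, g γ (g δ x) = g (γ * δ) x :=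
      Filter.eventually_all.2 fun γ => hmul γ δ
    filter_upwards [this] with x hx
    ext1 γ
    rw [hR, happ, happ, hx]

/-! ### Invariant balls in a manifold with a finite group action -/

section Manifold

variable {n : ℕ} {M : Type*} [TopologicalSpace M] [ChartedSpace (EuclideanSpace ℝ (Fin n)) M]
  [IsManifold (𝓡 n) ∞ M] {Γ : Type*} [Group Γ] [MulAction Γ M]

/-- Every point `y` of a manifold with an action of a finite group has arbitrarily small
neighbourhoods that are diffeomorphic to a ball, and that are preserved by the stabiliser of `y`
and disjoint from their other translates. -/
theorem exists_invariant_ball [T2Space M] [Finite Γ]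
    (hΓ : ∀ γ : Γ, ContMDiff (𝓡 n) (𝓡 n) ∞ (fun x : M => γ • x)) (y : M) {N : Set M}
    (hN : N ∈ 𝓝 y) :
    ∃ (e : OpenPartialHomeomorph (Euc n) M) (r : ℝ), 0 < r ∧ e.source = Metric.ball 0 r ∧
      ContMDiffOn (𝓡 n) (𝓡 n) ∞ e e.source ∧ ContMDiffOn (𝓡 n) (𝓡 n) ∞ e.symm e.target ∧
      e 0 = y ∧ e.target ⊆ N ∧
      ∀ δ : Γ, ∀ x ∈ e.target, δ • x ∈ e.target → ∀ z ∈ e.target, δ • z ∈ e.target := by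
  set c := chartAt (Euc n) y
  have hyc : y ∈ c.source := mem_chart_source _ _
  have hc : ContMDiffOn (𝓡 n) (𝓡 n) ∞ c c.source := contMDiffOn_chart
  have hcs : ContMDiffOn (𝓡 n) (𝓡 n) ∞ c.symm c.target := contMDiffOn_chart_symm
  let G := MulAction.stabilizer Γ y
  have hGy : ∀ γ : G, (γ : Γ) • y = y := fun γ => γ.2
  -- On `N₀` all translates by the stabiliser stay in the domain of the chart `c`, so its action can
  -- be read there as the maps `g γ` fixing `c y`.
  have hcont : ∀ γ : Γ, Continuous fun x : M => γ • x := fun γ => (hΓ γ).continuous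
  let N₀ : Set M := ⋂ γ : G, (fun x : M => (γ : Γ) • x) ⁻¹' c.source
  have hN₀ : IsOpen N₀ := isOpen_iInter_of_finite fun γ => c.open_source.preimage (hcont γ)
  have hyN₀ : y ∈ N₀ := Set.mem_iInter.2 fun γ => by simpa [hGy γ] using hyc
  let S : Set (Euc n) := c.target ∩ c.symm ⁻¹' N₀
  have hS : IsOpen S := c.symm.isOpen_inter_preimage hN₀
  have haS : c y ∈ S := ⟨c.map_source hyc, by simpa [c.left_inv hyc] using hyN₀⟩
  let g : G → Euc n → Euc n := fun γ x => c ((γ : Γ) • c.symm x)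
  have hg : ∀ γ, ContDiffOn ℝ ∞ (g γ) S := fun γ => by
    rw [← contMDiffOn_iff_contDiffOn]
    exact hc.comp ((hΓ γ).comp_contMDiffOn (hcs.mono Set.inter_subset_left))
      fun x hx => Set.mem_iInter.1 hx.2 γ
  have hga : ∀ γ, g γ (c y) = c y := fun γ => by simp [g, c.left_inv hyc, hGy γ]
  have hg1 : ∀ᶠ x in 𝓝 (c y), g 1 x = x := by
    filter_upwards [hS.mem_nhds haS] with x hx
    simp [g, c.right_inv hx.1]
  have hmul : ∀ γ δ, ∀ᶠ x in 𝓝 (c y), g γ (g δ x) = g (γ * δ) x := fun γ δ => by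
    filter_upwards [hS.mem_nhds haS] with x hx
    have h1 : (δ : Γ) • c.symm x ∈ c.source := Set.mem_iInter.1 hx.2 δ
    simp [g, c.left_inv h1, mul_smul]
  obtain ⟨f, S', hS'S, hS', haS', hf, hfa, hfinj, hfimm, hnorm⟩ :=
    exists_norm_invariant_coordinates hS haS g hg hga hg1 hmul
  obtain ⟨e₁, he₁s, he₁f, he₁t, he₁symm⟩ := exists_openPartialHomeomorph hS'
    (contMDiffOn_iff_contDiffOn.2 hf) hfinj fun x hx => by
      rw [mfderiv_eq_fderiv]
      exact hfimm x hx
  have hS'c : S' ⊆ c.target := fun x hx => (hS'S hx).1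
  let τ : OpenPartialHomeomorph (Euc n) M := e₁.symm.trans c.symm
  have hτs : τ.source = e₁.target := by
    rw [OpenPartialHomeomorph.trans_source]
    refine Set.inter_eq_left.2 fun x hx => hS'c ?_
    rw [← he₁s]
    exact e₁.map_target hx
  have hτy : y ∈ τ.target := by
    rw [OpenPartialHomeomorph.trans_target]
    exact ⟨hyc, by simpa [he₁s] using haS'⟩
  have hτsymm : ∀ x, τ.symm x = f (c x) := fun x => he₁f (c x)
  have hτsymm_y : τ.symm y = 0 := by rw [hτsymm, hfa]
  have hτ0 : τ 0 = y := by rw [← hτsymm_y, τ.right_inv hτy]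
  have hτsm : ContMDiffOn (𝓡 n) (𝓡 n) ∞ τ τ.source := by
    rw [hτs]
    refine hcs.comp he₁symm fun x hx => hS'c ?_
    rw [← he₁s]
    exact e₁.map_target hx
  have hτsm' : ContMDiffOn (𝓡 n) (𝓡 n) ∞ τ.symm τ.target := by
    have h1 : τ.target ⊆ c.source ∩ c ⁻¹' S' := by
      rw [OpenPartialHomeomorph.trans_target]
      intro x hx
      exact ⟨hx.1, by simpa [he₁s] using hx.2⟩
    refine ((contMDiffOn_iff_contDiffOn.2 hf).comp (hc.mono fun x hx => (h1 hx).1)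
      fun x hx => (h1 hx).2).congr fun x _ => hτsymm x
  -- a neighbourhood of `y` on which everything is as desired
  have hsep : ∀ᶠ V in (𝓝 y).smallSets, ∀ δ : Γ, δ • y ≠ y → ∀ x ∈ V, δ • x ∉ V := by
    refine Filter.eventually_all.2 fun δ => ?_
    by_cases hδ : δ • y = y
    · exact .of_forall fun V h => (h hδ).elim
    · obtain ⟨A, B, hA, hB, hyA, hyB, hAB⟩ := t2_separation (Ne.symm hδ)
      have h1 : A ∩ (fun x : M => δ • x) ⁻¹' B ∈ 𝓝 y :=
        (hA.inter (hB.preimage (hcont δ))).mem_nhds ⟨hyA, hyB⟩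
      refine Filter.eventually_smallSets.2 ⟨_, h1, fun V hV _ x hx hx' => ?_⟩
      exact Set.disjoint_left.1 hAB (hV hx').1 (hV hx).2
  obtain ⟨N₁, hN₁, hN₁sep⟩ := Filter.eventually_smallSets.1 hsep
  have hstab : ∀ᶠ x in 𝓝 y, ∀ δ : G, (δ : Γ) • x ∈ τ.target ∧
      ‖τ.symm ((δ : Γ) • x)‖ = ‖τ.symm x‖ := by
    refine Filter.eventually_all.2 fun δ => ?_
    have h1 : ∀ᶠ x in 𝓝 y, (δ : Γ) • x ∈ τ.target :=
      (hcont δ).continuousAt (τ.open_target.mem_nhds (by simpa [hGy δ] using hτy))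
    have h2 := (c.continuousAt hyc).eventually (hnorm δ)
    filter_upwards [h1, h2, c.open_source.mem_nhds hyc] with x hx1 hx2 hx3
    refine ⟨hx1, ?_⟩
    rw [hτsymm, hτsymm, ← hx2]
    simp [g, c.left_inv hx3]
  have hN₂ : ∀ᶠ x in 𝓝 (0 : Euc n), x ∈ τ.source ∧ τ x ∈ N ∧ τ x ∈ N₁ ∧ ∀ δ : G,
      (δ : Γ) • τ x ∈ τ.target ∧ ‖τ.symm ((δ : Γ) • τ x)‖ = ‖τ.symm (τ x)‖ := by
    have h0 : (0 : Euc n) ∈ τ.source := by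
      rw [← hτsymm_y]
      exact τ.map_target hτy
    have h1 := τ.continuousAt h0
    rw [ContinuousAt, hτ0] at h1
    filter_upwards [τ.open_source.mem_nhds h0, h1 hN, h1 hN₁, h1.eventually hstab] with
      x hx1 hx2 hx3 hx4
    exact ⟨hx1, hx2, hx3, hx4⟩
  obtain ⟨r, hr, hball⟩ := Metric.eventually_nhds_iff_ball.1 hN₂
  -- On this ball the stabiliser preserves the norm of the coordinates and hence the ball, while
  -- elements moving `y` send no point of it back into it.
  let e := τ.restrOpen (Metric.ball 0 r) Metric.isOpen_ball
  have hes : e.source = Metric.ball 0 r := by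
    rw [OpenPartialHomeomorph.restrOpen_source]
    exact Set.inter_eq_right.2 fun x hx => (hball x hx).1
  have het : ∀ {x}, x ∈ e.target → ∃ v ∈ Metric.ball (0 : Euc n) r, τ v = x := fun {x} hx =>
    ⟨e.symm x, hes ▸ e.map_target hx, e.right_inv hx⟩
  have het' : ∀ v ∈ Metric.ball (0 : Euc n) r, τ v ∈ e.target := fun v hv =>
    e.map_source (hes ▸ hv)
  have hett : e.target ⊆ τ.target := fun x hx => by
    obtain ⟨v, hv, rfl⟩ := het hx
    exact τ.map_source (hball v hv).1
  refine ⟨e, r, hr, hes, hτsm.mono fun x hx => ?_, hτsm'.mono hett, hτ0, fun x hx => ?_,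
    fun δ x hx hδx z hz => ?_⟩
  · exact (hball x (hes ▸ hx)).1
  · obtain ⟨v, hv, rfl⟩ := het hx
    exact (hball v hv).2.1
  · have hmem : ∀ {x}, x ∈ e.target → x ∈ N₁ := fun {x} hx => by
      obtain ⟨v, hv, rfl⟩ := het hx
      exact (hball v hv).2.2.1
    have hδ : δ • y = y := by
      by_contra h
      exact hN₁sep N₁ subset_rfl δ h x (hmem hx) (hmem hδx)
    obtain ⟨v, hv, rfl⟩ := het hz
    obtain ⟨h1, h2⟩ := (hball v hv).2.2.2 ⟨δ, hδ⟩
    rw [← τ.right_inv h1]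
    refine het' _ ?_
    have hvs := (hball v hv).1
    rw [mem_ball_zero_iff] at hv ⊢
    change ‖τ.symm (δ • τ v)‖ < r
    have h3 : ‖τ.symm (δ • τ v)‖ = ‖τ.symm (τ v)‖ := h2
    rwa [h3, τ.left_inv hvs]

end Manifold

/-! ### The orbifold atlas of the quotient of a manifold by a finite group -/

theorem perm_mem_of_eq_self {X : Type*} {S : Set X} {γ : Equiv.Perm X} (h : ∀ x ∉ S, γ x = x)
    {x : X} (hx : x ∈ S) : γ x ∈ S := by
  by_contra hγ
  exact hγ ((γ.injective (h _ hγ)).symm ▸ hx)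

theorem perm_inv_eq_self {X : Type*} {S : Set X} {γ : Equiv.Perm X} (h : ∀ x ∉ S, γ x = x) :
    ∀ x ∉ S, γ⁻¹ x = x := fun x hx => by
  rw [Equiv.Perm.inv_eq_iff_eq, h x hx]

section Group

variable {X M : Type*} {Γ : Type*} [Group Γ] [MulAction Γ M]

/-- The permutations of `S` that are induced by the action of `Γ` on `e '' S`. -/
def inducedGroup (Γ : Type*) [Group Γ] [MulAction Γ M] (S : Set X) (e : X → M) :
    Subgroup (Equiv.Perm X) where
  carrier := {g | (∀ x ∉ S, g x = x) ∧ ∃ δ : Γ, ∀ x ∈ S, e (g x) = δ • e x}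
  mul_mem' := by
    rintro g h ⟨hg, δ, hδ⟩ ⟨hh, ε, hε⟩
    refine ⟨fun x hx => ?_, δ * ε, fun x hx => ?_⟩
    · rw [Equiv.Perm.mul_apply, hh x hx, hg x hx]
    · rw [Equiv.Perm.mul_apply, hδ _ (perm_mem_of_eq_self hh hx), hε x hx, mul_smul]
  one_mem' := ⟨fun _ _ => rfl, 1, fun x _ => (one_smul Γ (e x)).symm⟩
  inv_mem' := by
    rintro g ⟨hg, δ, hδ⟩
    refine ⟨perm_inv_eq_self hg, δ⁻¹, fun x hx => ?_⟩
    rw [eq_inv_smul_iff, ← hδ _ (perm_mem_of_eq_self (perm_inv_eq_self hg) hx)]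
    exact congrArg e (g.apply_symm_apply x)

/-- As `e` is injective on `S`, an induced permutation is determined by any element of `Γ` inducing
it. -/
theorem finite_inducedGroup [Finite Γ] {S : Set X} {e : X → M} (he : Set.InjOn e S) :
    Finite (inducedGroup Γ S e) := by
  choose δ hδ using fun g : inducedGroup Γ S e => g.2.2
  refine Finite.of_injective δ fun g h hgh => Subtype.ext (Equiv.ext fun x => ?_)
  by_cases hx : x ∈ S
  · refine he (perm_mem_of_eq_self g.2.1 hx) (perm_mem_of_eq_self h.2.1 hx) ?_
    rw [hδ g x hx, hδ h x hx, hgh]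
  · rw [g.2.1 x hx, h.2.1 x hx]

theorem mk_eq_mk_iff {x y : M} :
    Quotient.mk (MulAction.orbitRel Γ M) x = Quotient.mk (MulAction.orbitRel Γ M) y ↔
      ∃ δ : Γ, δ • x = y := by
  rw [eq_comm]
  exact Quotient.eq

theorem mk_smul (δ : Γ) (x : M) :
    Quotient.mk (MulAction.orbitRel Γ M) (δ • x) = Quotient.mk (MulAction.orbitRel Γ M) x :=
  (mk_eq_mk_iff.2 ⟨δ, rfl⟩).symm

end Group

section Manifold

variable {n : ℕ} {M : Type*} [TopologicalSpace M] [ChartedSpace (EuclideanSpace ℝ (Fin n)) M]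
  {Γ : Type*} [Group Γ] [MulAction Γ M]

variable {U V W : OrbifoldChart n (Quotient (MulAction.orbitRel Γ M))} {σ τ ν : Euc n → M}

theorem IsLift.contMDiffAt (hσ : IsLift U σ) {u : Euc n} (hu : u ∈ U.dom) :
    ContMDiffAt (𝓡 n) (𝓡 n) ∞ σ u :=
  hσ.contMDiffOn.contMDiffAt (U.isOpen_dom.mem_nhds hu)

theorem IsLift.mdifferentiableAt (hσ : IsLift U σ) {u : Euc n} (hu : u ∈ U.dom) :
    MDifferentiableAt (𝓡 n) (𝓡 n) σ u :=
  (hσ.contMDiffAt hu).mdifferentiableAt (by simp)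

theorem IsLift.injOn (hσ : IsLift U σ) : Set.InjOn σ U.dom :=
  Set.injOn_iff_injective.2 hσ.isEmbedding.injective

/-- A ball in `M` that each element of `Γ` either preserves or makes disjoint from itself gives
an orbifold chart on `M / Γ`. -/
theorem exists_isLift_of_openPartialHomeomorph [Finite Γ]
    (hΓ : ∀ γ : Γ, ContMDiff (𝓡 n) (𝓡 n) ∞ (fun x : M => γ • x))
    (e : OpenPartialHomeomorph (Euc n) M) {r : ℝ} (hr : 0 < r)
    (hes : e.source = Metric.ball 0 r) (he : ContMDiffOn (𝓡 n) (𝓡 n) ∞ e e.source)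
    (he' : ContMDiffOn (𝓡 n) (𝓡 n) ∞ e.symm e.target)
    (hδ : ∀ δ : Γ, ∀ x ∈ e.target, δ • x ∈ e.target → ∀ z ∈ e.target, δ • z ∈ e.target) :
    ∃ U : OrbifoldChart n (Quotient (MulAction.orbitRel Γ M)), IsLift U e ∧ U.dom = e.source ∧
      IsOpen (U.toFun '' U.dom) := by
  classical
  have : ContinuousConstSMul Γ M := ⟨fun γ => (hΓ γ).continuous⟩
  have hopen : IsOpenMap fun x : M => Quotient.mk (MulAction.orbitRel Γ M) x :=
    isOpenMap_quotient_mk'_mul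
  have hcont : Continuous fun x : M => Quotient.mk (MulAction.orbitRel Γ M) x :=
    continuous_quotient_mk'
  have hemb : IsOpenEmbedding (e.source.domRestrict e) := e.isOpenEmbedding_restrict
  have hsm : ∀ g ∈ inducedGroup Γ (Metric.ball 0 r) e,
      ContDiffOn ℝ ∞ g (Metric.ball 0 r) := by
    rintro g ⟨hg, δ, hgδ⟩
    rw [← contMDiffOn_iff_contDiffOn]
    have h1 : ∀ x ∈ Metric.ball (0 : Euc n) r, g x = e.symm (δ • e x) := fun x hx => by
      rw [← hgδ x hx, e.left_inv (hes ▸ perm_mem_of_eq_self hg hx)]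
    refine ContMDiffOn.congr (he'.comp ((hΓ δ).comp_contMDiffOn (hes ▸ he)) fun x hx => ?_) h1
    change δ • e x ∈ e.target
    rw [← hgδ x hx]
    exact e.map_source (hes ▸ perm_mem_of_eq_self hg hx)
  have horb : ∀ x ∈ Metric.ball (0 : Euc n) r, ∀ y ∈ Metric.ball (0 : Euc n) r,
      Quotient.mk (MulAction.orbitRel Γ M) (e x) = Quotient.mk (MulAction.orbitRel Γ M) (e y) ↔
        ∃ γ ∈ inducedGroup Γ (Metric.ball 0 r) e, γ x = y := by
    intro x hx y hy
    have hxt : e x ∈ e.target := e.map_source (hes ▸ hx)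
    have hyt : e y ∈ e.target := e.map_source (hes ▸ hy)
    constructor
    · intro h
      obtain ⟨δ, hδxy⟩ := mk_eq_mk_iff.1 h
      have h1 : ∀ z ∈ e.target, δ • z ∈ e.target := hδ δ _ hxt (hδxy ▸ hyt)
      have h2 : ∀ z ∈ e.target, δ⁻¹ • z ∈ e.target :=
        hδ δ⁻¹ _ hyt (by rwa [← hδxy, inv_smul_smul])
      -- Since `δ` sends `e x` to `e y`, both `δ` and `δ⁻¹` preserve the ball in `M`; read through
      -- `e` and extended by the identity, they give mutually inverse permutations.
      let F : Γ → Euc n → Euc n := fun δ z => if z ∈ e.source then e.symm (δ • e z) else z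
      have hF : ∀ δ : Γ, (∀ z ∈ e.target, δ • z ∈ e.target) → ∀ z, F δ⁻¹ (F δ z) = z := by
        intro δ hδ z
        by_cases hz : z ∈ e.source
        · have h3 := hδ _ (e.map_source hz)
          simp only [F, if_pos hz, if_pos (e.map_target h3), e.right_inv h3, inv_smul_smul,
            e.left_inv hz]
        · simp only [F, if_neg hz]
      refine ⟨⟨F δ, F δ⁻¹, hF δ h1, fun z => by simpa using hF δ⁻¹ h2 z⟩,
        ⟨fun z hz => if_neg (hes ▸ hz), δ, fun z hz => ?_⟩, ?_⟩
      · rw [← hes] at hz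
        change e (F δ z) = _
        simp only [F, if_pos hz, e.right_inv (h1 _ (e.map_source hz))]
      · rw [← hes] at hx hy
        change F δ x = y
        simp only [F, if_pos hx, hδxy, e.left_inv hy]
    · rintro ⟨γ, ⟨-, δ, hγ⟩, rfl⟩
      rw [hγ x hx, mk_smul]
  let U : OrbifoldChart n (Quotient (MulAction.orbitRel Γ M)) :=
    { center := 0
      radius := r
      radius_pos := hr
      group := inducedGroup Γ (Metric.ball 0 r) e
      finite_group := finite_inducedGroup (hes ▸ e.injOn)
      eq_self_of_notMem := fun γ hγ => hγ.1
      smooth := hsm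
      toFun := fun x => Quotient.mk _ (e x)
      toFun_eq_iff := horb
      isQuotientMap := by
        rw [← hes]
        have h1 : IsOpenMap fun x : e.source => Quotient.mk (MulAction.orbitRel Γ M) (e x) :=
          hopen.comp hemb.isOpenMap
        have h2 : Continuous fun x : e.source => Quotient.mk (MulAction.orbitRel Γ M) (e x) :=
          hcont.comp hemb.continuous
        have h3 : ∀ x : e.source, Quotient.mk (MulAction.orbitRel Γ M) (e x) ∈
            (fun x => Quotient.mk (MulAction.orbitRel Γ M) (e x)) '' e.source :=
          fun x => ⟨x.1, x.2, rfl⟩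
        exact (h1.codRestrict h3).isQuotientMap (h2.codRestrict h3)
          Set.imageFactorization_surjective }
  have hU : U.dom = e.source := hes.symm
  refine ⟨U, ⟨?_, ?_, fun x hx => ?_, fun x hx => rfl⟩, hU, ?_⟩
  · rwa [hU]
  · rw [hU]
    exact hemb.isEmbedding
  · rw [hU] at hx
    have h1 : HasMFDerivAt (𝓡 n) (𝓡 n) e x (mfderiv (𝓡 n) (𝓡 n) e x) :=
      ((he.contMDiffAt (e.open_source.mem_nhds hx)).mdifferentiableAt (by simp)).hasMFDerivAt
    have h2 : HasMFDerivAt (𝓡 n) (𝓡 n) e.symm (e x) (mfderiv (𝓡 n) (𝓡 n) e.symm (e x)) :=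
      ((he'.contMDiffAt (e.open_target.mem_nhds (e.map_source hx))).mdifferentiableAt
        (by simp)).hasMFDerivAt
    have h3 := h2.comp x h1
    have h4 : HasMFDerivAt (𝓡 n) (𝓡 n) (e.symm ∘ e) x (ContinuousLinearMap.id ℝ (Euc n)) := by
      refine (hasMFDerivAt_id x).congr_of_eventuallyEq ?_
      filter_upwards [e.open_source.mem_nhds hx] with z hz using e.left_inv hz
    have h5 := hasMFDerivAt_unique h3 h4
    intro u v huv
    have h6 : ∀ z, mfderiv (𝓡 n) (𝓡 n) e.symm (e x) (mfderiv (𝓡 n) (𝓡 n) e x z) = z := fun z =>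
      DFunLike.congr_fun h5 z
    exact (h6 u).symm.trans ((congrArg _ huv).trans (h6 v))
  · have h1 : U.toFun '' U.dom = (fun x => Quotient.mk _ x) '' (e '' e.source) := by
      rw [hU, Set.image_image]
    rw [h1, e.image_source_eq_target]
    exact hopen _ e.open_target

/-- Translating makes lifts of two charts over the same point of `M / Γ` meet in `M`. It also forces
the form on `M` obtained from an orbifold form to be invariant. -/
theorem IsLift.smul (hΓ : ∀ γ : Γ, ContMDiff (𝓡 n) (𝓡 n) ∞ (fun x : M => γ • x))
    (hσ : IsLift U σ) (δ : Γ) : IsLift U fun x => δ • σ x := by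
  have hinj : ∀ x : M, Function.Injective (mfderiv (𝓡 n) (𝓡 n) (fun y : M => δ • y) x) := by
    intro x
    have h1 := (((hΓ δ⁻¹).mdifferentiableAt (x := δ • x) (by simp)).hasMFDerivAt).comp x
      ((hΓ δ).mdifferentiableAt (x := x) (by simp)).hasMFDerivAt
    have h2 := (hasMFDerivAt_id (I := 𝓡 n) x).congr_of_eventuallyEq
      (f₁ := (fun y : M => δ⁻¹ • y) ∘ fun y : M => δ • y)
      (.of_forall fun y => inv_smul_smul δ y)
    have h3 := hasMFDerivAt_unique h1 h2
    intro u v huv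
    have h4 := fun z => DFunLike.congr_fun h3 z
    exact (h4 u).symm.trans ((congrArg _ huv).trans (h4 v))
  refine ⟨(hΓ δ).comp_contMDiffOn hσ.contMDiffOn, ?_, fun x hx => ?_, fun x hx => ?_⟩
  · have : ContinuousConstSMul Γ M := ⟨fun γ => (hΓ γ).continuous⟩
    exact (Homeomorph.smul δ).isEmbedding.comp hσ.isEmbedding
  · have h : mfderiv (𝓡 n) (𝓡 n) (fun v => δ • σ v) x =
        (mfderiv (𝓡 n) (𝓡 n) (fun y : M => δ • y) (σ x)).comp (mfderiv (𝓡 n) (𝓡 n) σ x) :=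
      mfderiv_comp x ((hΓ δ).mdifferentiableAt (by simp)) (hσ.mdifferentiableAt hx)
    rw [h]
    exact (hinj (σ x)).comp (hσ.immersive x hx)
  · rw [mk_smul, hσ.comm x hx]

variable [IsManifold (𝓡 n) ∞ M]

theorem exists_isLift [T2Space M] [Finite Γ]
    (hΓ : ∀ γ : Γ, ContMDiff (𝓡 n) (𝓡 n) ∞ (fun x : M => γ • x)) (y : M) {N : Set M}
    (hN : N ∈ 𝓝 y) :
    ∃ (U : OrbifoldChart n (Quotient (MulAction.orbitRel Γ M))) (σ : Euc n → M), IsLift U σ ∧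
      IsOpen (U.toFun '' U.dom) ∧ (∃ u ∈ U.dom, σ u = y) ∧ Set.MapsTo σ U.dom N := by
  obtain ⟨e, r, hr, hes, he, he', he0, heN, hδ⟩ := exists_invariant_ball hΓ y hN
  obtain ⟨U, hU, hUe, hUo⟩ := exists_isLift_of_openPartialHomeomorph hΓ e hr hes he he' hδ
  exact ⟨U, e, hU, hUo, ⟨0, by rw [hUe, hes]; exact Metric.mem_ball_self hr, he0⟩,
    fun x hx => heN (e.map_source (hUe ▸ hx))⟩

theorem IsLift.exists_openPartialHomeomorph (hσ : IsLift U σ) :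
    ∃ e : OpenPartialHomeomorph (Euc n) M, e.source = U.dom ∧ (∀ x, e x = σ x) ∧
      e.target = σ '' U.dom ∧ ContMDiffOn (𝓡 n) (𝓡 n) ∞ e.symm e.target :=
  OrbForms.exists_openPartialHomeomorph U.isOpen_dom hσ.contMDiffOn hσ.injOn hσ.immersive

/-- The embedding is `σ⁻¹ ∘ ν`; it inherits the embedding and immersion properties from `ν = σ ∘ l`.
-/
theorem IsLift.exists_isChartEmbedding (hν : IsLift W ν) (hσ : IsLift U σ)
    (h : Set.MapsTo ν W.dom (σ '' U.dom)) :
    ∃ l, W.IsChartEmbedding U l ∧ ∀ x ∈ W.dom, σ (l x) = ν x := by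
  obtain ⟨e, hes, heσ, het, hsymm⟩ := hσ.exists_openPartialHomeomorph
  have hσl : ∀ x ∈ W.dom, σ (e.symm (ν x)) = ν x := fun x hx => by
    rw [← heσ]
    exact e.right_inv (het ▸ h hx)
  have hm : Set.MapsTo (e.symm ∘ ν) W.dom U.dom := fun x hx =>
    hes ▸ e.map_target (het ▸ h hx)
  have hl : ContMDiffOn (𝓡 n) (𝓡 n) ∞ (e.symm ∘ ν) W.dom :=
    hsymm.comp hν.contMDiffOn fun x hx => het ▸ h hx
  refine ⟨e.symm ∘ ν, ⟨hm, contMDiffOn_iff_contDiffOn.1 hl, ?_, fun x hx => ?_, fun x hx => ?_⟩,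
    hσl⟩
  · have h1 : IsEmbedding (U.dom.domRestrict σ ∘ hm.restrict _ _ _) := by
      have h2 : U.dom.domRestrict σ ∘ hm.restrict _ _ _ = W.dom.domRestrict ν :=
        funext fun x => hσl x x.2
      rw [h2]
      exact hν.isEmbedding
    have h3 : Continuous (hm.restrict _ _ _) := hl.continuousOn.mapsToRestrict hm
    exact IsEmbedding.subtypeVal.comp (IsEmbedding.of_comp h3 hσ.isEmbedding.continuous h1)
  · have h1 : mfderiv (𝓡 n) (𝓡 n) ν x =
        (mfderiv (𝓡 n) (𝓡 n) σ (e.symm (ν x))).comp (mfderiv (𝓡 n) (𝓡 n) (e.symm ∘ ν) x) := by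
      have h2 : ν =ᶠ[𝓝 x] σ ∘ (e.symm ∘ ν) := by
        filter_upwards [W.isOpen_dom.mem_nhds hx] with z hz using (hσl z hz).symm
      have h3 : MDifferentiableAt (𝓡 n) (𝓡 n) (e.symm ∘ ν) x :=
        (hl.contMDiffAt (W.isOpen_dom.mem_nhds hx)).mdifferentiableAt (by simp)
      exact h2.mfderiv_eq.trans (mfderiv_comp x (hσ.mdifferentiableAt (hm hx)) h3)
    have h4 := hν.immersive x hx
    rw [h1, mfderiv_eq_fderiv] at h4
    exact Function.Injective.of_comp (f := mfderiv (𝓡 n) (𝓡 n) σ (e.symm (ν x))) h4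
  · rw [← hσ.comm _ (hm hx), ← hν.comm x hx]
    exact congrArg _ (hσl x hx)

/-- Two lifts with a common value restrict to the same lift of a smaller chart. -/
theorem IsLift.exists_common [T2Space M] [Finite Γ]
    (hΓ : ∀ γ : Γ, ContMDiff (𝓡 n) (𝓡 n) ∞ (fun x : M => γ • x)) (hσ : IsLift U σ)
    (hτ : IsLift V τ) {u v : Euc n} (hu : u ∈ U.dom) (hv : v ∈ V.dom) (huv : σ u = τ v) :
    ∃ (W : OrbifoldChart n (Quotient (MulAction.orbitRel Γ M))) (l l' : Euc n → Euc n) (z : Euc n),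
      IsOpen (W.toFun '' W.dom) ∧ W.IsChartEmbedding U l ∧ W.IsChartEmbedding V l' ∧ z ∈ W.dom ∧
      l z = u ∧ l' z = v ∧ ∀ x ∈ W.dom, σ (l x) = τ (l' x) := by
  obtain ⟨e, -, -, het, -⟩ := hσ.exists_openPartialHomeomorph
  obtain ⟨e', -, -, het', -⟩ := hτ.exists_openPartialHomeomorph
  have hN : σ '' U.dom ∩ τ '' V.dom ∈ 𝓝 (σ u) := by
    refine Filter.inter_mem ?_ ?_
    · exact het ▸ e.open_target.mem_nhds (het ▸ ⟨u, hu, rfl⟩)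
    · exact het' ▸ e'.open_target.mem_nhds (het' ▸ ⟨v, hv, huv.symm⟩)
  obtain ⟨W, ν, hν, hWo, ⟨z, hz, hzu⟩, hm⟩ := exists_isLift hΓ (σ u) hN
  obtain ⟨l, hl, hlν⟩ := hν.exists_isChartEmbedding hσ fun x hx => (hm hx).1
  obtain ⟨l', hl', hlν'⟩ := hν.exists_isChartEmbedding hτ fun x hx => (hm hx).2
  refine ⟨W, l, l', z, hWo, hl, hl', hz, hσ.injOn (hl.mapsTo hz) hu ?_,
    hτ.injOn (hl'.mapsTo hz) hv ?_, fun x hx => (hlν x hx).trans (hlν' x hx).symm⟩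
  · rw [hlν z hz, hzu]
  · rw [hlν' z hz, hzu, huv]

/-- Over a common point of two charts the lifts take values in one orbit. After translating one lift
the values coincide, and a small invariant ball around that value embeds into both charts. -/
theorem isOrbifoldAtlas_quotientAtlas [T2Space M] [Finite Γ]
    (hΓ : ∀ γ : Γ, ContMDiff (𝓡 n) (𝓡 n) ∞ (fun x : M => γ • x)) :
    IsOrbifoldAtlas (quotientAtlas n M Γ) := by
  refine ⟨fun x => ?_, ?_⟩
  · obtain ⟨y, rfl⟩ := Quotient.exists_rep x
    obtain ⟨U, σ, hσ, -, ⟨u, hu, huy⟩, -⟩ := exists_isLift hΓ y Filter.univ_mem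
    exact ⟨U, ⟨σ, hσ⟩, u, hu, by rw [← hσ.comm u hu, huy]⟩
  · rintro U ⟨σ, hσ⟩ V ⟨τ, hτ⟩ _ ⟨⟨u, hu, rfl⟩, v, hv, hvu⟩
    have h1 : Quotient.mk (MulAction.orbitRel Γ M) (τ v) = Quotient.mk _ (σ u) := by
      rw [hσ.comm u hu, hτ.comm v hv, hvu]
    obtain ⟨δ, hδ⟩ := mk_eq_mk_iff.1 h1
    obtain ⟨W, l, l', z, hWo, hl, hl', hz, hzu, -, -⟩ :=
      hσ.exists_common hΓ (hτ.smul hΓ δ) hu hv hδ.symm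
    exact ⟨W, hWo, ⟨z, hz, by rw [← hl.comm z hz, hzu]⟩, ⟨l, hl⟩, l', hl'⟩

/-- Smooth maps to `M` factor locally through lifts of charts. -/
theorem exists_factorization [T2Space M] [Finite Γ]
    (hΓ : ∀ γ : Γ, ContMDiff (𝓡 n) (𝓡 n) ∞ (fun x : M => γ • x)) {m : ℕ} {q : Euc m → M}
    (hq : ContMDiff (𝓡 m) (𝓡 n) ∞ q) (u : Euc m) :
    ∃ (U : OrbifoldChart n (Quotient (MulAction.orbitRel Γ M))) (σ : Euc n → M) (r : ℝ)
      (f : Euc m → Euc n), IsLift U σ ∧ 0 < r ∧ ContDiffOn ℝ ∞ f (Metric.ball u r) ∧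
      Set.MapsTo f (Metric.ball u r) U.dom ∧ ∀ x ∈ Metric.ball u r, q x = σ (f x) := by
  obtain ⟨U, σ, hσ, -, ⟨v, hv, hvu⟩, -⟩ := exists_isLift hΓ (q u) Filter.univ_mem
  obtain ⟨e, hes, heσ, het, hsymm⟩ := hσ.exists_openPartialHomeomorph
  have h1 : q ⁻¹' e.target ∈ 𝓝 u := hq.continuous.continuousAt
    (e.open_target.mem_nhds (by rw [het]; exact ⟨v, hv, hvu⟩))
  obtain ⟨r, hr, hrq⟩ := Metric.mem_nhds_iff.1 h1
  refine ⟨U, σ, r, e.symm ∘ q, hσ, hr, ?_, fun x hx => hes ▸ e.map_target (hrq hx),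
    fun x hx => ?_⟩
  · rw [← contMDiffOn_iff_contDiffOn]
    exact hsymm.comp hq.contMDiffOn hrq
  · rw [← heσ]
    exact (e.right_inv (hrq hx)).symm

/-- The generators of each diffeology are plots of the other: chart maps are `π ∘ σ` for a lift `σ`,
and smooth maps to `M` factor locally through lifts. -/
theorem orbifoldDiffeology_quotientAtlas [T2Space M] [Finite Γ]
    (hΓ : ∀ γ : Γ, ContMDiff (𝓡 n) (𝓡 n) ∞ (fun x : M => γ • x)) :
    orbifoldDiffeology (quotientAtlas n M Γ) = quotientDiffeology n M Γ := by
  refine le_antisymm (DiffeologicalSpace.generateFrom_le_iff.2 ?_)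
    (DiffeologicalSpace.generateFrom_le_iff.2 ?_)
  · rintro m p ⟨U, ⟨σ, hσ⟩, f, hf, hfm, hp⟩
    refine DiffeologicalSpace.isPlot_generatedFrom_of_mem ⟨σ ∘ f, ?_, ?_⟩
    · rw [← contMDiffOn_univ]
      exact hσ.contMDiffOn.comp hf.contMDiff.contMDiffOn fun u _ => hfm u
    · exact hp.trans (funext fun u => (hσ.comm _ (hfm u)).symm)
  · rintro m p ⟨q, hq, hp⟩
    refine (orbifoldDiffeology (quotientAtlas n M Γ)).locality fun u => ?_
    obtain ⟨U, σ, r, f, hσ, hr, hf, hfm, hqf⟩ := exists_factorization hΓ hq u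
    refine ⟨Metric.ball u r, Metric.isOpen_ball, Metric.mem_ball_self hr, fun {l g} hgm hg => ?_⟩
    have h1 : p ∘ g = U.toFun ∘ (f ∘ g) := funext fun x => by
      have h2 : p (g x) = Quotient.mk (MulAction.orbitRel Γ M) (q (g x)) := congrFun hp (g x)
      rw [Function.comp_apply, h2, hqf _ (hgm x), hσ.comm _ (hfm (hgm x))]
      rfl
    rw [h1]
    exact plot_of_lift (A := quotientAtlas n M Γ) ⟨U, σ, hσ⟩
      (contDiffOn_univ.1 (hf.comp hg.contDiffOn fun x _ => hgm x)) fun x => hfm (hgm x)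

end Manifold

/-! ### Orbifold forms on the quotient and invariant forms -/

section Manifold

variable {n k : ℕ} {M : Type*} [TopologicalSpace M] [ChartedSpace (EuclideanSpace ℝ (Fin n)) M]
  {Γ : Type*} [Group Γ] [MulAction Γ M]

/-- The orbifold form `s` is given in charts by the pullback of `w` along lifts. -/
def IsLiftPullback (s : OrbifoldForm (quotientAtlas n M Γ) k) (w : InvariantForm n M Γ k) : Prop :=
  ∀ (U : quotientAtlas n M Γ) (σ : Euc n → M), IsLift U.1 σ →
    Set.EqOn (s.1 U) (mpullback σ w.1) U.1.dom

theorem IsLiftPullback.add {s s' : OrbifoldForm (quotientAtlas n M Γ) k}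
    {w w' : InvariantForm n M Γ k} (h : IsLiftPullback s w) (h' : IsLiftPullback s' w') :
    IsLiftPullback (s + s') (w + w') := fun U σ hσ u hu => by
  change s.1 U u + s'.1 U u = _
  rw [h U σ hσ hu, h' U σ hσ hu]
  rfl

theorem IsLiftPullback.smul {s : OrbifoldForm (quotientAtlas n M Γ) k}
    {w : InvariantForm n M Γ k} (c : ℝ) (h : IsLiftPullback s w) :
    IsLiftPullback (c • s) (c • w) := fun U σ hσ u hu => by
  change c • s.1 U u = _
  rw [h U σ hσ hu]
  rfl

theorem isLiftPullback_left_unique {s s' : OrbifoldForm (quotientAtlas n M Γ) k}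
    {w : InvariantForm n M Γ k} (h : IsLiftPullback s w) (h' : IsLiftPullback s' w) : s = s' := by
  refine Subtype.ext (funext fun U => funext fun u => ?_)
  by_cases hu : u ∈ U.1.dom
  · obtain ⟨σ, hσ⟩ := U.2
    rw [h U σ hσ hu, h' U σ hσ hu]
  · rw [s.2.2.1 U u hu, s'.2.2.1 U u hu]

/-- A finite group acts properly discontinuously and its quotient map is open, so the Hausdorff
property, local compactness and second countability descend to `M / Γ`; together they imply
paracompactness. -/
theorem t2Space_and_paracompactSpace_quotient [T2Space M]
    [SecondCountableTopology M] [Finite Γ]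
    (hΓ : ∀ γ : Γ, ContMDiff (𝓡 n) (𝓡 n) ∞ (fun x : M => γ • x)) :
    T2Space (Quotient (MulAction.orbitRel Γ M)) ∧
      ParacompactSpace (Quotient (MulAction.orbitRel Γ M)) := by
  have : ContinuousConstSMul Γ M := ⟨fun γ => (hΓ γ).continuous⟩
  have : LocallyCompactSpace M := ChartedSpace.locallyCompactSpace (Euc n) M
  have h1 : T2Space (Quotient (MulAction.orbitRel Γ M)) :=
    t2Space_of_properlyDiscontinuousSMul_of_t2Space
  have h2 : SecondCountableTopology (Quotient (MulAction.orbitRel Γ M)) :=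
    ContinuousConstSMul.secondCountableTopology
  have h3 : LocallyCompactSpace (Quotient (MulAction.orbitRel Γ M)) :=
    MulAction.isOpenQuotientMap_quotientMk.locallyCompactSpace
  exact ⟨h1, inferInstance⟩

variable [IsManifold (𝓡 n) ∞ M] [T2Space M] [Finite Γ]

theorem exists_isLift_apply_eq (hΓ : ∀ γ : Γ, ContMDiff (𝓡 n) (𝓡 n) ∞ (fun x : M => γ • x))
    (y : M) : ∃ (U : quotientAtlas n M Γ) (σ : Euc n → M) (u : Euc n), IsLift U.1 σ ∧
      u ∈ U.1.dom ∧ σ u = y := by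
  obtain ⟨U, σ, hσ, -, ⟨u, hu, huy⟩, -⟩ := exists_isLift hΓ y Filter.univ_mem
  exact ⟨⟨U, σ, hσ⟩, σ, u, hσ, hu, huy⟩

/-- Forms on `M` with the same pullbacks along lifts of charts are equal. -/
theorem eq_of_forall_isLift (hΓ : ∀ γ : Γ, ContMDiff (𝓡 n) (𝓡 n) ∞ (fun x : M => γ • x))
    {w w' : ∀ x : M, TangentSpace (𝓡 n) x [⋀^Fin k]→L[ℝ] ℝ}
    (h : ∀ (U : quotientAtlas n M Γ) (σ : Euc n → M), IsLift U.1 σ →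
      Set.EqOn (mpullback σ w) (mpullback σ w') U.1.dom) : w = w' := by
  funext y
  obtain ⟨U, σ, u, hσ, hu, rfl⟩ := exists_isLift_apply_eq (Γ := Γ) hΓ y
  exact eq_of_mpullback_eq (hσ.immersive u hu) (h U σ hσ hu)

theorem isLiftPullback_right_unique
    (hΓ : ∀ γ : Γ, ContMDiff (𝓡 n) (𝓡 n) ∞ (fun x : M => γ • x))
    {s : OrbifoldForm (quotientAtlas n M Γ) k} {w w' : InvariantForm n M Γ k}
    (h : IsLiftPullback s w) (h' : IsLiftPullback s w') : w = w' :=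
  Subtype.ext (eq_of_forall_isLift hΓ fun U σ hσ _ hu => (h U σ hσ hu).symm.trans (h' U σ hσ hu))

/-- One lift per chart is chosen to define `s`. Independence of this choice, invariance and
compatibility are all instances of `mpullback_eq_of_mk_eq`. -/
theorem exists_isLiftPullback_left
    (hΓ : ∀ γ : Γ, ContMDiff (𝓡 n) (𝓡 n) ∞ (fun x : M => γ • x)) (w : InvariantForm n M Γ k) :
    ∃ s : OrbifoldForm (quotientAtlas n M Γ) k, IsLiftPullback s w := by
  choose σ hσ using fun U : quotientAtlas n M Γ => U.2
  let s : quotientAtlas n M Γ → Euc n → Alt n k := fun U =>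
    U.1.dom.indicator (mpullback (σ U) w.1)
  have hs : ∀ U, Set.EqOn (s U) (mpullback (σ U) w.1) U.1.dom := fun U x hx =>
    Set.indicator_of_mem hx _
  have hpull : ∀ (W : OrbifoldChart n (Quotient (MulAction.orbitRel Γ M)))
      (U : quotientAtlas n M Γ) (l : Euc n → Euc n), ContDiffOn ℝ ∞ l W.dom →
      Set.MapsTo l W.dom U.1.dom →
      Set.EqOn (pullback l (s U)) (mpullback (σ U ∘ l) w.1) W.dom := fun W U l hl hlm x hx => by
    rw [mpullback_comp_apply ((hσ U).mdifferentiableAt (hlm hx))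
      ((hl.contDiffAt (W.isOpen_dom.mem_nhds hx)).differentiableAt (by simp))]
    exact pullback_congr (hs U (hlm hx))
  have hcompat : ∀ (W : OrbifoldChart n (Quotient (MulAction.orbitRel Γ M)))
      (U V : quotientAtlas n M Γ) (l l' : Euc n → Euc n), ContDiffOn ℝ ∞ l W.dom →
      ContDiffOn ℝ ∞ l' W.dom → Set.MapsTo l W.dom U.1.dom → Set.MapsTo l' W.dom V.1.dom →
      (∀ x ∈ W.dom, U.1.toFun (l x) = V.1.toFun (l' x)) →
      Set.EqOn (pullback l (s U)) (pullback l' (s V)) W.dom := by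
    intro W U V l l' hl hl' hlm hlm' h x hx
    rw [hpull W U l hl hlm hx, hpull W V l' hl' hlm' hx]
    refine mpullback_eq_of_mk_eq hΓ w W.isOpen_dom
      ((hσ U).contMDiffOn.comp hl.contMDiffOn hlm)
      ((hσ V).contMDiffOn.comp hl'.contMDiffOn hlm') (fun y hy => ?_) hx
    rw [Function.comp_apply, Function.comp_apply, (hσ U).comm _ (hlm hy), (hσ V).comm _ (hlm' hy),
      h y hy]
  refine ⟨⟨s, fun U => ?_, fun U x hx => Set.indicator_of_notMem hx _, fun U γ hγ => ?_,
    fun U V W l l' hl hl' => hcompat W U V l l' hl.contDiffOn hl'.contDiffOn hl.mapsTo hl'.mapsTo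
      fun x hx => (hl.comm x hx).trans (hl'.comm x hx).symm⟩, fun U τ hτ x hx => ?_⟩
  · exact (contDiffOn_mpullback w.2.1 U.1.isOpen_dom (hσ U).contMDiffOn).congr (hs U)
  · have h := hcompat U.1 U U γ id (U.1.smooth γ hγ) contDiffOn_id
      (fun x hx => U.1.mem_dom hγ hx) (fun x hx => hx) fun x hx => U.1.toFun_group hγ hx
    rwa [pullback_id] at h
  · refine (hs U hx).trans (mpullback_eq_of_mk_eq hΓ w U.1.isOpen_dom (hσ U).contMDiffOn
      hτ.contMDiffOn (fun y hy => ?_) hx)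
    rw [(hσ U).comm y hy, hτ.comm y hy]

/-- A lift through `y` has invertible derivative, so the value of `w` at `y` can be solved for from
the value of `s`. Comparison in a common smaller chart shows that every other lift gives the same
value. -/
theorem exists_isLiftPullback_right
    (hΓ : ∀ γ : Γ, ContMDiff (𝓡 n) (𝓡 n) ∞ (fun x : M => γ • x))
    (s : OrbifoldForm (quotientAtlas n M Γ) k) :
    ∃ w : InvariantForm n M Γ k, IsLiftPullback s w := by
  choose V τ v hτ hv hvy using exists_isLift_apply_eq (n := n) (M := M) hΓ
  have hex : ∀ y : M, ∃ w : Alt n k,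
      w.compContinuousLinearMap (mfderiv (𝓡 n) (𝓡 n) (τ y) (v y) : Euc n →L[ℝ] Euc n) =
        s.1 (V y) (v y) := fun y =>
    exists_compContinuousLinearMap_eq ((hτ y).immersive _ (hv y)) _
  choose w₀ hw₀ using hex
  let w : ∀ x : M, TangentSpace (𝓡 n) x [⋀^Fin k]→L[ℝ] ℝ := w₀
  have hw : ∀ y, mpullback (τ y) w (v y) = s.1 (V y) (v y) := fun y => by
    rw [← hw₀ y]
    change (w₀ (τ y (v y))).compContinuousLinearMap _ = _
    rw [hvy y]
    rfl
  have hlift : ∀ (U : quotientAtlas n M Γ) (σ : Euc n → M), IsLift U.1 σ →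
      Set.EqOn (s.1 U) (mpullback σ w) U.1.dom := by
    intro U σ hσ u hu
    obtain ⟨W, l, l', z, -, hl, hl', hz, rfl, hzv, hll'⟩ :=
      hσ.exists_common hΓ (hτ (σ u)) hu (hv (σ u)) (hvy (σ u)).symm
    have hld : ∀ {l : Euc n → Euc n} {U}, W.IsChartEmbedding U l → DifferentiableAt ℝ l z :=
      fun h => (h.contDiffOn.contDiffAt (W.isOpen_dom.mem_nhds hz)).differentiableAt (by simp)
    refine eq_of_pullback_eq (LinearMap.injective_iff_surjective.1 (hl.immersive z hz)) ?_
    rw [s.2.2.2.2 U (V (σ (l z))) W l l' hl hl' hz,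
      ← mpullback_comp_apply (hσ.mdifferentiableAt (hl.mapsTo hz)) (hld hl)]
    have h1 : σ ∘ l =ᶠ[𝓝 z] τ (σ (l z)) ∘ l' := by
      filter_upwards [W.isOpen_dom.mem_nhds hz] with x hx using hll' x hx
    rw [mpullback_congr_map h1, mpullback_comp_apply
      ((hτ (σ (l z))).mdifferentiableAt (hl'.mapsTo hz)) (hld hl')]
    refine pullback_congr ?_
    rw [hzv]
    exact (hw (σ (l z))).symm
  refine ⟨⟨w, fun e he => fun a ha => ContDiffAt.contDiffWithinAt ?_, fun γ y => ?_⟩, hlift⟩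
  · have hes : ContMDiffOn (𝓡 n) (𝓡 n) ∞ e.symm e.target :=
      contMDiffOn_symm_of_mem_maximalAtlas (IsManifold.subset_maximalAtlas he)
    obtain ⟨U, σ, u, hσ, hu, hua⟩ := exists_isLift_apply_eq (Γ := Γ) hΓ (e.symm a)
    obtain ⟨c, hcs, hcσ, hct, hcsymm⟩ := hσ.exists_openPartialHomeomorph
    obtain rfl : (c : Euc n → M) = σ := funext hcσ
    have hac : e.symm a ∈ c.target := by
      rw [hct]
      exact ⟨u, hu, hua⟩
    have key := fun b (hb : b ∈ e.target) (hbc : e.symm b ∈ c.target) =>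
      mpullback_eq_pullback w (e := c) (hcs ▸ hσ.contMDiffOn) hcsymm
        (hes.contMDiffAt (e.open_target.mem_nhds hb)) hbc
    have hev : mpullback e.symm w =ᶠ[𝓝 a] pullback (c.symm ∘ e.symm) (s.1 U) := by
      filter_upwards [e.open_target.mem_nhds ha,
        e.symm.continuousAt ha (c.open_target.mem_nhds hac)] with b hb hbc
      refine (key b hb hbc).2.trans (pullback_congr ?_)
      exact (hlift U c hσ (hcs ▸ c.map_target hbc)).symm
    refine ContDiffAt.congr_of_eventuallyEq (contDiffAt_pullback ?_ (key a ha hac).1) hev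
    exact (s.2.1 U).contDiffAt (U.1.isOpen_dom.mem_nhds (hcs ▸ c.map_target hac))
  · obtain ⟨U, σ, u, hσ, hu, rfl⟩ := exists_isLift_apply_eq (Γ := Γ) hΓ y
    -- Both `γ • σ` and `σ` lift the chart `U`, so `w` has the same pullback `s U` along them;
    -- cancelling the invertible derivative of `σ` gives invariance.
    have h1 := (hlift U _ (hσ.smul hΓ γ) hu).symm.trans (hlift U σ hσ hu)
    have h2 : mfderiv (𝓡 n) (𝓡 n) (fun v => γ • σ v) u =
        (mfderiv (𝓡 n) (𝓡 n) (fun y : M => γ • y) (σ u)).comp (mfderiv (𝓡 n) (𝓡 n) σ u) :=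
      mfderiv_comp u ((hΓ γ).mdifferentiableAt (by simp)) (hσ.mdifferentiableAt hu)
    simp only [mpullback, h2] at h1
    exact compContinuousLinearMap_injective (E := Euc n) (F := Euc n)
      (bijective_of_injective (L := mfderiv (𝓡 n) (𝓡 n) σ u) (hσ.immersive u hu)).2 h1

/-- The exterior derivative of orbifold forms corresponds to that of invariant forms. -/
theorem IsLiftPullback.orbD {s : OrbifoldForm (quotientAtlas n M Γ) k} {w : InvariantForm n M Γ k}
    (hΓ : ∀ γ : Γ, ContMDiff (𝓡 n) (𝓡 n) ∞ (fun x : M => γ • x)) (h : IsLiftPullback s w)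
    {w' : InvariantForm n M Γ (k + 1)} (h' : IsLiftPullback (orbD s) w') :
    w'.1 = mextDeriv w.1 := by
  -- The family `mextDeriv w.1` enters without a proof of smoothness or invariance; both follow from
  -- its equality with `w'`.
  refine eq_of_forall_isLift hΓ fun U σ hσ u hu => ?_
  rw [← h' U σ hσ hu, mpullback_mextDeriv w.2.1 U.1.isOpen_dom hσ.contMDiffOn hu]
  refine (Set.indicator_of_mem hu _).trans ?_
  exact ((h U σ hσ).eventuallyEq_of_mem (U.1.isOpen_dom.mem_nhds hu)).extDeriv_eq

/-- If a diffeological form and an invariant form correspond to the same orbifold form, then the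
latter is the pullback of the former to `M`. -/
theorem IsChartPullback.eq_mpullback
    (hΓ : ∀ γ : Γ, ContMDiff (𝓡 n) (𝓡 n) ∞ (fun x : M => γ • x))
    {D : DiffeologicalSpace (Quotient (MulAction.orbitRel Γ M))} {β : DiffForm D k}
    {s : OrbifoldForm (quotientAtlas n M Γ) k} {w : InvariantForm n M Γ k}
    (hβ : IsChartPullback β s) (hs : IsLiftPullback s w) (p : Plot D) (q : Euc p.dim → M)
    (hq : ContMDiff (𝓡 p.dim) (𝓡 n) ∞ q)
    (hp : p.toFun = fun u => Quotient.mk (MulAction.orbitRel Γ M) (q u)) :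
    β.1 p = mpullback q w.1 := by
  funext u
  obtain ⟨U, σ, r, f, hσ, hr, hf, hfm, hqf⟩ := exists_factorization hΓ hq u
  have hb : ContDiff ℝ ∞ (ballMap u r) := contDiff_ballMap _ _
  have hbm : ∀ v, ballMap u r v ∈ Metric.ball u r := ballMap_mem hr
  refine eq_of_pullback_ballMap hr ?_ (Metric.mem_ball_self hr)
  have hfb : ContDiff ℝ ∞ (f ∘ ballMap u r) :=
    contDiffOn_univ.1 (hf.comp hb.contDiffOn fun v _ => hbm v)
  refine (β.2.2 p _ _ hb).symm.trans ?_
  refine (hβ ⟨U, σ, hσ⟩ (p.reparam _ hb) _ hfb (fun v => hfm (hbm v)) (funext fun v => ?_)).trans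
    (funext fun v => ?_)
  · change p.toFun (ballMap u r v) = U.toFun (f (ballMap u r v))
    rw [hp, ← hσ.comm _ (hfm (hbm v)), ← hqf _ (hbm v)]
  · have h1 : pullback (f ∘ ballMap u r) (s.1 ⟨U, σ, hσ⟩) v =
        pullback (f ∘ ballMap u r) (mpullback σ w.1) v :=
      pullback_congr (hs ⟨U, σ, hσ⟩ σ hσ (hfm (hbm v)))
    have h2 : σ ∘ (f ∘ ballMap u r) = q ∘ ballMap u r := funext fun v => (hqf _ (hbm v)).symm
    refine h1.trans ((mpullback_comp_apply (f := f ∘ ballMap u r)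
      (hσ.mdifferentiableAt (hfm (hbm v))) (hfb.differentiable (by simp) v)).symm.trans ?_)
    rw [h2]
    exact mpullback_comp_apply (hq.mdifferentiableAt (by simp)) (hb.differentiable (by simp) v)

end Manifold

end OrbForms



/-! ### Assembly of the two parts of the theorem -/

theorem mainTheorem6 :
    -- every orbifold
    (∀ (n : ℕ) (X : Type*) [TopologicalSpace X] [T2Space X] [ParacompactSpace X]
      (A : Set (OrbForms.OrbifoldChart n X)), OrbForms.IsOrbifoldAtlas A →
      ∃ Φ : ∀ k : ℕ, OrbForms.DiffForm (OrbForms.orbifoldDiffeology A) k ≃ₗ[ℝ]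
          OrbForms.OrbifoldForm A k,
        (∀ k β, OrbForms.IsChartPullback β (Φ k β)) ∧
        (∀ k β, Φ (k + 1) (OrbForms.diffD β) = OrbForms.orbD (Φ k β))) ∧
    -- quotients of manifolds by finite groups
    (∀ (n : ℕ) (M : Type*) [TopologicalSpace M] [T2Space M] [SecondCountableTopology M]
      [ChartedSpace (EuclideanSpace ℝ (Fin n)) M] [IsManifold (𝓡 n) ∞ M]
      (Γ : Type*) [Group Γ] [Finite Γ] [MulAction Γ M],
      (∀ γ : Γ, ContMDiff (𝓡 n) (𝓡 n) ∞ (fun x : M => γ • x)) →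
      T2Space (Quotient (MulAction.orbitRel Γ M)) ∧
      ParacompactSpace (Quotient (MulAction.orbitRel Γ M)) ∧
      OrbForms.IsOrbifoldAtlas (OrbForms.quotientAtlas n M Γ) ∧
      OrbForms.orbifoldDiffeology (OrbForms.quotientAtlas n M Γ) =
        OrbForms.quotientDiffeology n M Γ ∧
      ∃ (P : ∀ k : ℕ, OrbForms.DiffForm (OrbForms.quotientDiffeology n M Γ) k ≃ₗ[ℝ]
            OrbForms.InvariantForm n M Γ k)
        (Q : ∀ k : ℕ, OrbForms.OrbifoldForm (OrbForms.quotientAtlas n M Γ) k ≃ₗ[ℝ]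
            OrbForms.InvariantForm n M Γ k),
        -- `P` is the pullback along the quotient map
        (∀ k β (p : OrbForms.Plot (OrbForms.quotientDiffeology n M Γ))
          (q : OrbForms.Euc p.dim → M), ContMDiff (𝓡 p.dim) (𝓡 n) ∞ q →
          p.toFun = (fun u => Quotient.mk (MulAction.orbitRel Γ M) (q u)) →
          β.1 p = OrbForms.mpullback q (P k β).1) ∧
        -- `Q` is given in charts by the pullback along lifts
        (∀ k s (U : OrbForms.quotientAtlas n M Γ) (σ : OrbForms.Euc n → M),
          OrbForms.IsLift U.1 σ →
          Set.EqOn (s.1 U) (OrbForms.mpullback σ (Q k s).1) U.1.dom) ∧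
        -- the resulting isomorphism of diffeological forms and orbifold forms
        (∀ k β, OrbForms.IsChartPullback β ((Q k).symm (P k β))) ∧
        (∀ k β, (P (k + 1) (OrbForms.diffD β)).1 = OrbForms.mextDeriv (P k β).1) ∧
        (∀ k s, (Q (k + 1) (OrbForms.orbD s)).1 = OrbForms.mextDeriv (Q k s).1)) := by
  refine ⟨fun n X _ _ _ A hA => OrbForms.exists_equiv_orbifoldForm hA rfl, ?_⟩
  intro n M _ _ _ _ _ Γ _ _ _ hΓ
  obtain ⟨hT2, hpara⟩ := OrbForms.t2Space_and_paracompactSpace_quotient hΓ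
  have hA := OrbForms.isOrbifoldAtlas_quotientAtlas (M := M) hΓ
  have hD := OrbForms.orbifoldDiffeology_quotientAtlas (M := M) hΓ
  obtain ⟨Φ, hΦ, hΦd⟩ := OrbForms.exists_equiv_orbifoldForm hA hD
  choose Q hQ using fun k => OrbForms.exists_linearEquiv_of_rel
    (fun (s : OrbForms.OrbifoldForm (OrbForms.quotientAtlas n M Γ) k)
      (w : OrbForms.InvariantForm n M Γ k) => OrbForms.IsLiftPullback s w)
    (fun _ _ _ _ => OrbForms.IsLiftPullback.add) (fun c _ _ => OrbForms.IsLiftPullback.smul c)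
    (OrbForms.exists_isLiftPullback_right hΓ) (OrbForms.exists_isLiftPullback_left hΓ)
    (fun _ _ _ => OrbForms.isLiftPullback_right_unique hΓ)
    fun _ _ _ => OrbForms.isLiftPullback_left_unique
  have hQd : ∀ k s, (Q (k + 1) (OrbForms.orbD s)).1 = OrbForms.mextDeriv (Q k s).1 :=
    fun k s => (hQ k s).orbD hΓ (hQ _ _)
  -- The isomorphism `P` is defined as `Φ` followed by `Q`, so its composite with the inverse of `Q`
  -- is the pullback along charts; that it is the pullback along the quotient map is
  -- `IsChartPullback.eq_mpullback`.
  refine ⟨hT2, hpara, hA, hD, fun k => (Φ k).trans (Q k), Q, fun k β p q hq hp =>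
    (hΦ k β).eq_mpullback hΓ (hQ k _) p q hq hp, hQ, fun k β => ?_, fun k β => ?_, hQd⟩
  · rw [LinearEquiv.trans_apply, LinearEquiv.symm_apply_apply]
    exact hΦ k β
  · rw [LinearEquiv.trans_apply, hΦd]
    exact hQd k _
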